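/- \textbf{Theorem (Weak Direct Sum).} All inputs lie in finite sets and all protocols are deterministic two-party protocols: finite binary trees in which every inner node is owned by Alice or Bob, the owner sends one bit that depends only on the owner's own input (and on the node), and every leaf is labelled with an output. The cost of a protocol is the maximal number of bits sent. For finite sets $\mathcal X,\mathcal Y$, a function $f:\mathcal X\times\mathcal Y\to\{0,1\}$, a probability distribution $\mu$ on $\mathcal X\times\mathcal Y$ and $\varepsilon\ge 0$, let $D^{\mu}_{\varepsilon}(f)$ be the least cost of a protocol whose output $\pi(x,y)$ satisfies $\Pr_{(x,y)\sim\mu}[\pi(x,y)\ne f(x,y)]\le\varepsilon$. For $n\ge 0$, let $D^{\mu^n}_{\varepsilon}(f^n)$ be the least cost of a protocol with inputs $x\in\mathcal X^n$, $y\in\mathcal Y^n$ and output $\pi(x,y)\in\{0,1\}^n$ whose error is at most $\varepsilon$ on each copy, i.e. $\Pr[\pi(x,y)_i\ne f(x_i,y_i)]\le\varepsilon$ for every $i\in\{1,\dots,n\}$, where the pairs $(x_1,y_1),\dots,(x_n,y_n)$ are independent samples from $\mu$. Then for every Boolean function $f$, every distribution $\mu$ and every constant $\delta>0$, $$D^{\mu^n}_{\varepsilon}(f^n)\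 \ge\ \tilde\Omega_\delta\big(\sqrt n\cdot D^{\mu}_{\varepsilon+\delta}(f)\big).$$ Explicitly: there is an absolute constant $k\in\mathbb N$ such that for every $\delta>0$ there is $c=c(\delta)>0$ such that, for all finite sets $\mathcal X,\mathcal Y$, all $f:\mathcal X\times\mathcal Y\to\{0,1\}$, all distributions $\mu$ on $\mathcal X\times\mathcal Y$, all $\varepsilon\ge0$ and all integers $n\ge 0$, $$D^{\mu^n}_{\varepsilon}(f^n)\ \ge\ c\cdot\frac{g}{\big(\log(2+g)\big)^{k}},\qquad g:=\sqrt n\cdot D^{\mu}_{\varepsilon+\delta}(f).$$ -/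

import Mathlib

/-- Deterministic two-party communication protocols with inputs in `X` (Alice) and `Y` (Bob) and
outputs in `Z`: finite binary trees. Each inner node is owned by one player, who sends one bit
depending on that player's input only; the bit `false` continues in the first subtree, `true` in the
second. Each leaf is labelled by the output, so the output is determined by the transcript. -/
inductive CommProtocol (X Y Z : Type*) where
  | output (z : Z) : CommProtocol X Y Z
  | alice (message : X → Bool) (next₀ next₁ : CommProtocol X Y Z) : CommProtocol X Y Z
  | bob (message : Y → Bool) (next₀ next₁ : CommProtocol X Y Z) : CommProtocol X Y Z

namespace CommProtocol

/-- The output of the protocol on the input pair `(x, y)`. -/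
def run {X Y Z : Type*} (x : X) (y : Y) : CommProtocol X Y Z → Z
  | output z => z
  | alice message next₀ next₁ => bif message x then next₁.run x y else next₀.run x y
  | bob message next₀ next₁ => bif message y then next₁.run x y else next₀.run x y

/-- The communication cost: the largest number of bits sent, i.e. the depth of the tree. -/
def cost {X Y Z : Type*} : CommProtocol X Y Z → ℕ
  | output _ => 0
  | alice _ next₀ next₁ => max next₀.cost next₁.cost + 1
  | bob _ next₀ next₁ => max next₀.cost next₁.cost + 1

end CommProtocol

open Classical in
/-- The probability of the event `E` under the distribution with point masses `μ`. -/
noncomputable def eventProb {Ω : Type*} [Fintype Ω] (μ : Ω → ℝ) (E : Ω → Prop) : ℝ :=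
  ∑ ω with E ω, μ ω

/-- The point masses of `μⁿ`, the law of `n` independent samples `(xᵢ, yᵢ)` from `μ`, regarded as a
distribution on pairs `((x₁, …, xₙ), (y₁, …, yₙ))`. -/
def powDist {X Y : Type*} (μ : X × Y → ℝ) (n : ℕ) (p : (Fin n → X) × (Fin n → Y)) : ℝ :=
  ∏ i, μ (p.1 i, p.2 i)

/-- The distributional communication complexity of `f` under `μ` with error `ε`: the least cost
of a deterministic protocol whose output differs from `f x y` with probability at most `ε`. -/
noncomputable def distCC {X Y Z : Type*} [Fintype X] [Fintype Y]
    (μ : X × Y → ℝ) (ε : ℝ) (f : X → Y → Z) : ℕ :=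
  sInf {c : ℕ | ∃ π : CommProtocol X Y Z, π.cost = c ∧
    eventProb μ (fun p => π.run p.1 p.2 ≠ f p.1 p.2) ≤ ε}

/-- The distributional communication complexity of `fⁿ` under `μⁿ` with error `ε` on each copy: the
least cost of a deterministic protocol with outputs in `Zⁿ` such that, for each `i`, the `i`-th
coordinate of its output differs from `f xᵢ yᵢ` with probability at most `ε`. -/
noncomputable def distCCPow {X Y Z : Type*} [Fintype X] [Fintype Y]
    (μ : X × Y → ℝ) (ε : ℝ) (f : X → Y → Z) (n : ℕ) : ℕ :=
  sInf {c : ℕ | ∃ π : CommProtocol (Fin n → X) (Fin n → Y) (Fin n → Z), π.cost = c ∧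
    ∀ i : Fin n, eventProb (powDist μ n)
      (fun p => π.run p.1 p.2 i ≠ f (p.1 i) (p.2 i)) ≤ ε}

/-! Take a protocol of cost `C` for `n` copies. For a history `v`, let `bitMean k v` be the
probability that the next bit is `true`, given `v`, the inputs `xᵢ` with `i < k` and the inputs `yᵢ`
with `i ≥ k`. The inputs reaching `v` form a rectangle and the copies are independent, so under this
conditioning the players' remaining inputs are independent (`historyWeight_cross`). Hence, at
Alice's nodes, these means form a martingale in `k`; at Bob's nodes, a reversed one. Either way the
expected squared increments sum to at most one per bit (`sum_sq_bitMean_le`), so for some copy `j`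
the expected absolute increments along the transcript add up to at most `C / √n`
(`exists_copy_sum_abs_le`).

To compute `f` on one input pair, the players put it in place of copy `j` of a publicly sampled
input. Alice can then compute `bitMean (j + 1)` and Bob `bitMean j`. If the owner's mean is used at
each node, the simulated history has the right joint law with copy `j` (`sum_simulated`). With a
common random threshold, the two players' bits differ with probability equal to the difference of
their means, so along the joint path they differ `C / √n` times on average
(`exists_coupled_simulation`). Each disagreement is located by binary search on random hashes and
corrected, at a cost of `O_δ(log² (2 + C))` bits; about `2 * C / (δ * √n)` corrections suffice by
Markov (`simulate_run`, `exists_simulating_protocol`). Finally the randomness is fixed.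

If `C / √n ≤ δ`, disagreements are so rare that a constant output is good enough (`distCC_eq_zero`).
Both cases give `√n * D ≤ B * C * log (2 + C) ^ 2`, which is then inverted. -/

/-! ### Histories as bit lists. -/

/-- The history (newest bit first) after `t` further steps from the history `v`, when the next bit
after the history `u` is `g u`. -/
def extendHistory (g : List Bool → Bool) (v : List Bool) : ℕ → List Bool
  | 0 => v
  | t + 1 => g (extendHistory g v t) :: extendHistory g v t

theorem extendHistory_length (g : List Bool → Bool) (v : List Bool) (t : ℕ) :
    (extendHistory g v t).length = v.length + t := by
  induction t with
  | zero => rfl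
  | succ t ih => simp [extendHistory, ih]; omega

theorem extendHistory_add (g : List Bool → Bool) (v : List Bool) (s t : ℕ) :
    extendHistory g v (s + t) = extendHistory g (extendHistory g v s) t := by
  induction t with
  | zero => rfl
  | succ t ih => rw [← add_assoc]; simp [extendHistory, ih]

theorem extendHistory_suffix (g : List Bool → Bool) (v : List Bool) (t : ℕ) :
    v <:+ extendHistory g v t := by
  induction t with
  | zero => exact List.suffix_rfl
  | succ t ih => exact ih.trans (List.suffix_cons _ _)

theorem extendHistory_ne_of_le {a b : List Bool → Bool} {v : List Bool} {s t : ℕ} (hst : s ≤ t)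
    (h : extendHistory a v s ≠ extendHistory b v s) :
    extendHistory a v t ≠ extendHistory b v t := by
  induction t, hst using Nat.le_induction with
  | base => exact h
  | succ t _ ih => intro h'; exact ih (List.cons.inj h').2

theorem extendHistory_eq_of_agree {a g : List Bool → Bool} {v : List Bool} {t : ℕ}
    (h : ∀ i < t, a (extendHistory g v i) = g (extendHistory g v i)) :
    extendHistory a v t = extendHistory g v t := by
  induction t with
  | zero => rfl
  | succ t ih =>
    have := ih fun i hi => h i (by omega)
    simp only [extendHistory, this, h t (by omega)]

/-! ### Protocols viewed along histories. -/

namespace CommProtocol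

variable {X Y Z : Type*}

/-- The subtree entered after the bit `b`; a leaf is left unchanged. -/
def child : CommProtocol X Y Z → Bool → CommProtocol X Y Z
  | output z, _ => output z
  | alice _ l r, b => bif b then r else l
  | bob _ l r, b => bif b then r else l

/-- The subtree reached by a history (newest bit first). -/
def subtree (π : CommProtocol X Y Z) : List Bool → CommProtocol X Y Z
  | [] => π
  | b :: v => (π.subtree v).child b

/-- The bit sent at the root; `false` at a leaf. -/
def rootMessage : CommProtocol X Y Z → X → Y → Bool
  | output _, _, _ => false
  | alice m _ _, x, _ => m x
  | bob m _ _, _, y => m y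

/-- Whether the root is not owned by Bob. -/
def aliceOwned : CommProtocol X Y Z → Bool
  | output _ => true
  | alice _ _ _ => true
  | bob _ _ _ => false

/-- The label of the leftmost leaf. -/
def leftLabel : CommProtocol X Y Z → Z
  | output z => z
  | alice _ l _ => l.leftLabel
  | bob _ l _ => l.leftLabel

/-- The bit sent after a history. -/
def message (π : CommProtocol X Y Z) (v : List Bool) (x : X) (y : Y) : Bool :=
  (π.subtree v).rootMessage x y

/-- The history of the first `t` bits on the inputs `x`, `y`. -/
def transcript (π : CommProtocol X Y Z) (x : X) (y : Y) (t : ℕ) : List Bool :=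
  extendHistory (fun v => π.message v x y) [] t

theorem message_eq_of_alice {π : CommProtocol X Y Z} {v : List Bool}
    (h : (π.subtree v).aliceOwned = true) (x : X) (y y' : Y) :
    π.message v x y = π.message v x y' := by
  unfold message
  cases hs : π.subtree v <;> simp_all [aliceOwned, rootMessage]

theorem message_eq_of_bob {π : CommProtocol X Y Z} {v : List Bool}
    (h : (π.subtree v).aliceOwned = false) (x x' : X) (y : Y) :
    π.message v x y = π.message v x' y := by
  unfold message
  cases hs : π.subtree v <;> simp_all [aliceOwned, rootMessage]

theorem run_child (π : CommProtocol X Y Z) (x : X) (y : Y) :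
    (π.child (π.rootMessage x y)).run x y = π.run x y := by
  cases π with
  | output z => rfl
  | alice m l r => simp only [child, rootMessage, run]; cases m x <;> rfl
  | bob m l r => simp only [child, rootMessage, run]; cases m y <;> rfl

theorem cost_child (π : CommProtocol X Y Z) (b : Bool) : (π.child b).cost ≤ π.cost - 1 := by
  cases π <;> cases b <;> simp [child, cost]

theorem cost_subtree (π : CommProtocol X Y Z) (v : List Bool) :
    (π.subtree v).cost ≤ π.cost - v.length := by
  induction v with
  | nil => simp [subtree]
  | cons b v ih =>
    have := (π.subtree v).cost_child b
    simp only [subtree, List.length_cons]; omega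

theorem eq_output_of_cost_eq_zero {π : CommProtocol X Y Z} (h : π.cost = 0) :
    π = output π.leftLabel := by
  cases π <;> simp_all [cost, leftLabel]

theorem run_subtree_transcript (π : CommProtocol X Y Z) (x : X) (y : Y) (t : ℕ) :
    (π.subtree (π.transcript x y t)).run x y = π.run x y := by
  induction t with
  | zero => rfl
  | succ t ih => rw [← ih]; exact run_child _ x y

theorem leftLabel_transcript (π : CommProtocol X Y Z) (x : X) (y : Y) {t : ℕ} (h : π.cost ≤ t) :
    (π.subtree (π.transcript x y t)).leftLabel = π.run x y := by
  have h0 : (π.subtree (π.transcript x y t)).cost = 0 := by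
    have := π.cost_subtree (π.transcript x y t)
    rw [transcript, extendHistory_length] at this
    simp only [transcript]
    simp at this; omega
  rw [← run_subtree_transcript π x y t]
  conv_rhs => rw [eq_output_of_cost_eq_zero h0]
  rfl

/-- From depth `π.cost` on only leaves remain, and they absorb bits. A player who overshoots the end
of the transcript therefore still reads the right label. -/
theorem leftLabel_subtree_cons (π : CommProtocol X Y Z) (b : Bool) {v : List Bool}
    (h : π.cost ≤ v.length) :
    (π.subtree (b :: v)).leftLabel = (π.subtree v).leftLabel := by
  have h0 : (π.subtree v).cost = 0 := by have := π.cost_subtree v; omega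
  simp only [subtree]
  rw [eq_output_of_cost_eq_zero h0]
  rfl

/-- Alice sends the bits of `m x`, and the protocol continues according to them. -/
def sendBits : (s : ℕ) → (X → Fin s → Bool) → ((Fin s → Bool) → CommProtocol X Y Z) →
    CommProtocol X Y Z
  | 0, _, k => k Fin.elim0
  | s + 1, m, k => alice (fun x => m x 0)
      (sendBits s (fun x i => m x i.succ) fun z => k (Fin.cons false z))
      (sendBits s (fun x i => m x i.succ) fun z => k (Fin.cons true z))

theorem run_sendBits (s : ℕ) (m : X → Fin s → Bool) (k : (Fin s → Bool) → CommProtocol X Y Z)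
    (x : X) (y : Y) : (sendBits s m k).run x y = (k (m x)).run x y := by
  induction s with
  | zero =>
    simp only [sendBits]
    congr 2
    exact Subsingleton.elim _ _
  | succ s ih =>
    simp only [sendBits, run, ih]
    have h : m x = Fin.cons (m x 0) fun i => m x i.succ := (Fin.cons_self_tail (m x)).symm
    cases hb : m x 0 <;> rw [hb] at h <;> simp only [cond_true, cond_false] <;> rw [← h]

theorem cost_sendBits (s : ℕ) (m : X → Fin s → Bool) (k : (Fin s → Bool) → CommProtocol X Y Z)
    {c : ℕ} (hk : ∀ z, (k z).cost ≤ c) : (sendBits s m k).cost ≤ c + s := by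
  induction s with
  | zero => exact hk _
  | succ s ih =>
    simp only [sendBits, cost]
    have h0 := ih (fun x i => m x i.succ) (fun z => k (Fin.cons false z)) fun z => hk _
    have h1 := ih (fun x i => m x i.succ) (fun z => k (Fin.cons true z)) fun z => hk _
    omega

/-! ### Following a joint path by locating and correcting disagreements. -/

section Simulation

variable {s : ℕ} (hash : List Bool → Fin s → Bool) (own : List Bool → Bool)
  (a : X → List Bool → Bool) (b : Y → List Bool → Bool)

/-- Starting from the histories `α x` and `β y` held by the players, find by binary lifting on
hash values the longest common extension (of length less than `2 ^ i`), then let Alice announce the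
correct bit after the first disagreement. -/
def findDisagreement (k : (X → List Bool) → (Y → List Bool) → CommProtocol X Y Z) :
    ℕ → (X → List Bool) → (Y → List Bool) → CommProtocol X Y Z
  | 0, α, β => alice (fun x => bif own (α x) then a x (α x) else !a x (α x))
      (k (fun x => false :: α x) fun y => false :: β y)
      (k (fun x => true :: α x) fun y => true :: β y)
  | i + 1, α, β => sendBits s (fun x => hash (extendHistory (a x) (α x) (2 ^ i))) fun z =>
      bob (fun y => decide (hash (extendHistory (b y) (β y) (2 ^ i)) = z))
        (findDisagreement k i α β)
        (findDisagreement k i (fun x => extendHistory (a x) (α x) (2 ^ i))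
          fun y => extendHistory (b y) (β y) (2 ^ i))

/-- Correct `K` disagreements; then Alice sends the label of her history extended by `C` bits. -/
def simulate (lab : List Bool → Bool) (C L : ℕ) :
    ℕ → (X → List Bool) → (Y → List Bool) → CommProtocol X Y Bool
  | 0, α, _ => alice (fun x => lab (extendHistory (a x) (α x) C)) (output false) (output true)
  | K + 1, α, β => findDisagreement hash own a b (simulate lab C L K) L α β

theorem cost_findDisagreement {k : (X → List Bool) → (Y → List Bool) → CommProtocol X Y Z} {c : ℕ}
    (hk : ∀ α β, (k α β).cost ≤ c) (i : ℕ) (α : X → List Bool) (β : Y → List Bool) :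
    (findDisagreement hash own a b k i α β).cost ≤ c + (i * (s + 1) + 1) := by
  induction i generalizing α β with
  | zero =>
    simp only [findDisagreement, cost]
    have := hk (fun x => false :: α x) fun y => false :: β y
    have := hk (fun x => true :: α x) fun y => true :: β y
    omega
  | succ i ih =>
    refine (cost_sendBits (c := c + (i * (s + 1) + 1) + 1) _ _ _ fun z => ?_).trans ?_
    · simp only [cost]
      have := ih α β
      have := ih (fun x => extendHistory (a x) (α x) (2 ^ i))
        fun y => extendHistory (b y) (β y) (2 ^ i)
      omega
    · rw [Nat.succ_mul]; omega

theorem cost_simulate (lab : List Bool → Bool) (C L K : ℕ) (α : X → List Bool)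
    (β : Y → List Bool) :
    (simulate hash own a b lab C L K α β).cost ≤ K * (L * (s + 1) + 1) + 1 := by
  induction K generalizing α β with
  | zero => simp [simulate, cost]
  | succ K ih =>
    refine (cost_findDisagreement hash own a b (fun α β => ih α β) L α β).trans ?_
    rw [Nat.succ_mul]; omega

variable {own a b}

/-- The correct next bit. -/
def ownerBit (own : List Bool → Bool) (a b : List Bool → Bool) (v : List Bool) : Bool :=
  bif own v then a v else b v

/-- Histories only grow. Once Alice's history extends `v`, it does so whatever the hashes and Bob's
history are, so every branch ends in the same output. -/
theorem findDisagreement_of_suffix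
    {k : (X → List Bool) → (Y → List Bool) → CommProtocol X Y Z} {x : X} {y : Y} {z : Z}
    {v : List Bool} (hk : ∀ α β, v <:+ α x → (k α β).run x y = z) (i : ℕ) (α : X → List Bool)
    (β : Y → List Bool) (h : v <:+ α x) :
    (findDisagreement hash own a b k i α β).run x y = z := by
  induction i generalizing α β with
  | zero =>
    simp only [findDisagreement, run]
    rw [hk _ _ (h.trans (List.suffix_cons _ _)), hk _ _ (h.trans (List.suffix_cons _ _)),
      Bool.cond_self]
  | succ i ih =>
    simp only [findDisagreement, run_sendBits, run]
    rw [ih _ _ (h.trans (extendHistory_suffix _ _ _)), ih _ _ h, Bool.cond_self]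

/-- Invariant of the binary search: both players stand at `T m`, and either their own continuations
split within `2 ^ i` steps or this window passes `C`. Halving the window, equal hashes move both
players forward and unequal ones keep them in place. At `i = 0` the split is at the very next bit.
-/
theorem findDisagreement_run
    {k : (X → List Bool) → (Y → List Bool) → CommProtocol X Y Z} {x : X} {y : Y} {z : Z}
    {C : ℕ} (T : ℕ → List Bool) (hT : T = extendHistory (ownerBit own (a x) (b y)) [])
    (hhash : ∀ m ≤ C, ∀ r ≤ C, hash (extendHistory (a x) (T m) r) =
      hash (extendHistory (b y) (T m) r) →
        extendHistory (a x) (T m) r = extendHistory (b y) (T m) r)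
    (hdone : ∀ α β, T C <:+ α x → (k α β).run x y = z) (m₀ : ℕ)
    (hk : ∀ α β m, m₀ ≤ m → m < C → a x (T m) ≠ b y (T m) → α x = T (m + 1) → β y = T (m + 1) →
      (k α β).run x y = z) (i m : ℕ) (hi : ∀ i' < i, 2 ^ i' ≤ C) (hm₀ : m₀ ≤ m) (hm : m ≤ C)
    (α : X → List Bool) (β : Y → List Bool) (hα : α x = T m) (hβ : β y = T m)
    (hd : extendHistory (a x) (T m) (2 ^ i) ≠ extendHistory (b y) (T m) (2 ^ i) ∨ C < m + 2 ^ i) :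
    (findDisagreement hash own a b k i α β).run x y = z := by
  have hsuf : ∀ m, C ≤ m → T C <:+ T m := by
    intro m hm
    obtain ⟨r, rfl⟩ := Nat.exists_eq_add_of_le hm
    rw [hT, extendHistory_add]
    exact extendHistory_suffix _ _ _
  induction i generalizing m α β with
  | zero =>
    rcases Nat.lt_or_ge m C with hmC | hmC
    · have hne : a x (T m) ≠ b y (T m) := by
        rcases hd with hd | hd
        · intro h; apply hd; simp [extendHistory, h]
        · simp at hd; omega
      -- The two bits are known to differ, so Alice obtains Bob's bit by negating her own.
      have hbit : (bif own (α x) then a x (α x) else !a x (α x)) =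
          ownerBit own (a x) (b y) (T m) := by
        rw [hα, ownerBit]
        cases own (T m) <;> cases h1 : a x (T m) <;> cases h2 : b y (T m) <;> simp_all
      have hT' : T (m + 1) = ownerBit own (a x) (b y) (T m) :: T m := by
        rw [hT]; rfl
      simp only [findDisagreement, run]
      rw [hbit]
      cases hb : ownerBit own (a x) (b y) (T m) <;> rw [hb] at hT' <;>
        exact hk _ _ m hm₀ hmC hne (by rw [hT', hα]) (by rw [hT', hβ])
    · refine findDisagreement_of_suffix hash hdone 0 α β ?_
      rw [hα]; exact hsuf m hmC
  | succ i ih =>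
    simp only [findDisagreement, run_sendBits, run]
    rw [hα, hβ]
    have hpow : 2 ^ (i + 1) = 2 ^ i + 2 ^ i := by ring
    by_cases heq : extendHistory (a x) (T m) (2 ^ i) = extendHistory (b y) (T m) (2 ^ i)
    · rw [heq, decide_eq_true rfl, cond_true]
      -- Equal extensions agree at all intermediate steps, so ownership does not matter there and
      -- both coincide with the joint path.
      have hTm : extendHistory (a x) (T m) (2 ^ i) = T (m + 2 ^ i) := by
        rw [hT, extendHistory_add, ← hT]
        apply extendHistory_eq_of_agree
        have key : ∀ j ≤ 2 ^ i,
            extendHistory (ownerBit own (a x) (b y)) (T m) j = extendHistory (a x) (T m) j ∧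
            extendHistory (a x) (T m) j = extendHistory (b y) (T m) j := by
          intro j hj
          have h2 : extendHistory (a x) (T m) j = extendHistory (b y) (T m) j := by
            by_contra hne
            exact extendHistory_ne_of_le hj hne heq
          refine ⟨?_, h2⟩
          induction j with
          | zero => rfl
          | succ j ihj =>
            have h3 := h2
            simp only [extendHistory] at h3
            obtain ⟨h4, h5⟩ := List.cons.inj h3
            have := ihj (by omega) h5
            simp only [extendHistory]
            rw [this, ownerBit]
            rw [← h5] at h4
            rw [← h4, Bool.cond_self]
        intro j hj
        obtain ⟨h1, h2⟩ := key j hj.le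
        have h3 := (key (j + 1) hj).1
        simp only [extendHistory] at h3
        rw [(List.cons.inj h3).1, h1]
      rcases Nat.lt_or_ge C (m + 2 ^ i) with hlt | hge
      · refine findDisagreement_of_suffix hash hdone i _ _ ?_
        simp only [hα, hTm]
        exact hsuf _ hlt.le
      · refine ih (m + 2 ^ i) (fun i' h => hi i' (by omega)) (Nat.le_add_right_of_le hm₀) hge _ _ ?_ ?_ ?_
        · simp only [hα, hTm]
        · simp only [hβ, ← heq, hTm]
        · rcases hd with hd | hd
          · left
            rw [hpow, extendHistory_add, extendHistory_add, ← heq, hTm] at hd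
            exact hd
          · right; omega
    · have hne : hash (extendHistory (b y) (T m) (2 ^ i)) ≠
          hash (extendHistory (a x) (T m) (2 ^ i)) := fun h =>
        heq (hhash m hm _ (hi i (by omega)) h.symm)
      rw [decide_eq_false hne, cond_false]
      exact ih m (fun i' h => hi i' (by omega)) hm₀ hm α β hα hβ (Or.inl heq)

theorem label_of_suffix {lab : List Bool → Bool} {C : ℕ}
    (hlab : ∀ c v, C ≤ v.length → lab (c :: v) = lab v) {u v : List Bool} (hv : C ≤ v.length)
    (h : v <:+ u) : lab u = lab v := by
  obtain ⟨w, rfl⟩ := h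
  induction w with
  | nil => rfl
  | cons c w ih => rw [List.cons_append, hlab _ _ (by simp; omega), ih]

/-- Each round either passes the end of the path or uses up one disagreement ahead of the common
position. When none is left, Alice's own continuation is the joint path. -/
theorem simulate_run {lab : List Bool → Bool} {C L : ℕ}
    (hlab : ∀ c v, C ≤ v.length → lab (c :: v) = lab v) {x : X} {y : Y}
    (T : ℕ → List Bool) (hT : T = extendHistory (ownerBit own (a x) (b y)) [])
    (hhash : ∀ m ≤ C, ∀ r ≤ C, hash (extendHistory (a x) (T m) r) =
      hash (extendHistory (b y) (T m) r) →
        extendHistory (a x) (T m) r = extendHistory (b y) (T m) r)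
    (hL : ∀ i < L, 2 ^ i ≤ C) (hL' : C < 2 ^ L) (K : ℕ) (m : ℕ) (hm : m ≤ C)
    (hK : ((Finset.Ico m C).filter fun t => a x (T t) ≠ b y (T t)).card ≤ K)
    (α : X → List Bool) (β : Y → List Bool) (hα : α x = T m) (hβ : β y = T m) :
    (simulate hash own a b lab C L K α β).run x y = lab (T C) := by
  have hlen : C ≤ (T C).length := by rw [hT, extendHistory_length]; omega
  have hend : ∀ (x : X) (α : X → List Bool) (β : Y → List Bool),
      T C <:+ extendHistory (a x) (α x) C →
      (simulate hash own a b lab C L 0 α β).run x y = lab (T C) := by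
    intro x α β h
    simp only [simulate, run]
    rw [label_of_suffix hlab hlen h]
    cases lab (T C) <;> rfl
  have hdone : ∀ K α β, T C <:+ α x →
      (simulate hash own a b lab C L K α β).run x y = lab (T C) := by
    intro K
    induction K with
    | zero => exact fun α β h => hend x α β (h.trans (extendHistory_suffix _ _ _))
    | succ K ih => exact fun α β h => findDisagreement_of_suffix hash ih L α β h
  induction K generalizing m α β with
  | zero =>
    apply hend
    have hagree : ∀ t, m ≤ t → t < C → a x (T t) = b y (T t) := by
      intro t h1 h2
      by_contra h3
      have : t ∈ (Finset.Ico m C).filter fun t => a x (T t) ≠ b y (T t) := by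
        simp [h1, h2, h3]
      rw [Nat.le_zero, Finset.card_eq_zero] at hK
      simp [hK] at this
    obtain ⟨r, rfl⟩ := Nat.exists_eq_add_of_le hm
    have : extendHistory (a x) (T m) r = T (m + r) := by
      rw [hT, extendHistory_add, ← hT]
      apply extendHistory_eq_of_agree
      intro i hi
      have h := hagree (m + i) (by omega) (by omega)
      have hTi : T (m + i) = extendHistory (ownerBit own (a x) (b y)) (T m) i := by
        rw [hT, extendHistory_add]
      rw [← hTi, ownerBit, ← h, Bool.cond_self]
    rw [hα, add_comm m r, extendHistory_add, this, add_comm m r]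
    exact extendHistory_suffix _ _ _
  | succ K ih =>
    refine findDisagreement_run hash T hT hhash (hdone K) m ?_ L m hL le_rfl hm α β hα hβ
      (Or.inr (by omega))
    intro α' β' m' h1 h2 h3 h4 h5
    refine ih (m' + 1) h2 ?_ α' β' h4 h5
    -- The corrected position `m'` leaves the set, so the count drops strictly.
    refine Nat.le_of_lt_succ (lt_of_lt_of_le (Finset.card_lt_card ?_) hK)
    refine ⟨fun t ht => ?_, fun h => ?_⟩
    · simp only [Finset.mem_filter, Finset.mem_Ico] at ht ⊢
      exact ⟨⟨by omega, ht.1.2⟩, ht.2⟩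
    · have := h (Finset.mem_filter.2 ⟨Finset.mem_Ico.2 ⟨h1, h2⟩, h3⟩)
      simp at this

end Simulation

end CommProtocol

/-! ### Conditional means under conditional independence. -/

section CondExp

variable {X Y U W : Type*} [Fintype X] [Fintype Y]

open Classical in
/-- The conditional mean of `m` given the values of `u x` and `w y`, under the weights `G`. -/
noncomputable def condMean (G m : X → Y → ℝ) (u : X → U) (w : Y → W) (x : X) (y : Y) : ℝ :=
  (∑ x', ∑ y', if u x = u x' ∧ w y = w y' then G x' y' * m x' y' else 0) /
    ∑ x', ∑ y', if u x = u x' ∧ w y = w y' then G x' y' else 0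

theorem condMean_congr (G m : X → Y → ℝ) {u : X → U} {w : Y → W} {x x' : X} {y y' : Y}
    (hx : u x = u x') (hy : w y = w y') : condMean G m u w x y = condMean G m u w x' y' := by
  unfold condMean; rw [hx, hy]

theorem condMean_swap (G m : X → Y → ℝ) (u : X → U) (w : Y → W) (x : X) (y : Y) :
    condMean (fun y x => G x y) (fun y x => m x y) w u y x = condMean G m u w x y := by
  unfold condMean
  congr 1 <;> rw [Finset.sum_comm] <;>
    refine Finset.sum_congr rfl fun x' _ => Finset.sum_congr rfl fun y' _ => ?_ <;>
    split_ifs <;> simp_all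

theorem condMean_mem_Icc {G m : X → Y → ℝ} (hG : ∀ x y, 0 ≤ G x y)
    (hm : ∀ x y, m x y ∈ Set.Icc (0 : ℝ) 1) (u : X → U) (w : Y → W) (x : X) (y : Y) :
    condMean G m u w x y ∈ Set.Icc (0 : ℝ) 1 := by
  classical
  constructor
  · refine div_nonneg ?_ ?_ <;> refine Finset.sum_nonneg fun x' _ => Finset.sum_nonneg fun y' _ => ?_
    · split_ifs
      exacts [mul_nonneg (hG _ _) (hm _ _).1, le_rfl]
    · split_ifs
      exacts [hG _ _, le_rfl]
  · refine div_le_one_of_le₀ ?_ ?_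
    · refine Finset.sum_le_sum fun x' _ => Finset.sum_le_sum fun y' _ => ?_
      split_ifs
      exacts [mul_le_of_le_one_right (hG _ _) (hm _ _).2, le_rfl]
    · refine Finset.sum_nonneg fun x' _ => Finset.sum_nonneg fun y' _ => ?_
      split_ifs
      exacts [hG _ _, le_rfl]

/-- If `G` satisfies the cross identity and `m` depends on `x` only, then the conditional mean of
`m` given `u x`, `w y` is also its conditional mean given `u x`, `y`. -/
theorem sum_condMean_left {G m φ : X → Y → ℝ} {u : X → U} {w : Y → W} (hG : ∀ x y, 0 ≤ G x y)
    (hcross : ∀ x x' y y', u x = u x' → w y = w y' → G x y * G x' y' = G x' y * G x y')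
    (hm : ∀ x y y', m x y = m x y') (hφ : ∀ x x' y, u x = u x' → φ x y = φ x' y) :
    ∑ x, ∑ y, G x y * condMean G m u w x y * φ x y = ∑ x, ∑ y, G x y * m x y * φ x y := by
  classical
  set D : X → Y → ℝ := fun x y => ∑ x', ∑ y', if u x = u x' ∧ w y = w y' then G x' y' else 0
    with hD
  have hDc : ∀ x x' y, u x = u x' → D x y = D x' y := by
    intro x x' y h; simp only [hD, h]
  have hexp : ∀ (c : X → Y → ℝ) x y,
      (∑ x', ∑ y', if u x = u x' ∧ w y = w y' then c x' y' else 0) * (φ x y / D x y) * G x y =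
        ∑ x', ∑ y', if u x = u x' ∧ w y = w y' then c x' y' * (φ x y / D x y) * G x y else 0 := by
    intro c x y
    simp only [Finset.sum_mul, ite_mul, zero_mul]
  have hstep : ∀ (x : X) (y : Y), G x y * condMean G m u w x y * φ x y =
      ∑ x', ∑ y', if u x = u x' ∧ w y = w y' then
        G x' y' * m x' y' * (φ x y / D x y) * G x y else 0 := by
    intro x y
    rw [← hexp, condMean]
    ring
  have hstep' : ∀ (x : X) (y : Y), G x y * m x y * φ x y =
      ∑ x', ∑ y', if u x = u x' ∧ w y = w y' then
        G x' y' * (m x y * φ x y / D x y) * G x y else 0 := by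
    intro x y
    have : (∑ x', ∑ y', if u x = u x' ∧ w y = w y' then
        G x' y' * (m x y * φ x y / D x y) * G x y else 0) =
        D x y * (m x y * φ x y / D x y) * G x y := by
      simp only [hD, Finset.sum_mul, ite_mul, zero_mul]
    rw [this]
    -- A vanishing denominator forces `G x y = 0`, so the value given to the quotient there is
    -- irrelevant.
    by_cases h0 : D x y = 0
    · have hle : G x y ≤ D x y := by
        have h1 : (if u x = u x ∧ w y = w y then G x y else 0) ≤
            ∑ y', if u x = u x ∧ w y = w y' then G x y' else 0 :=
          Finset.single_le_sum (f := fun y' => if u x = u x ∧ w y = w y' then G x y' else 0)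
            (fun y' _ => by split_ifs; exacts [hG _ _, le_rfl]) (Finset.mem_univ y)
        have h2 := Finset.single_le_sum
          (f := fun x' => ∑ y', if u x = u x' ∧ w y = w y' then G x' y' else 0)
          (fun x' _ => Finset.sum_nonneg fun y' _ => by
            split_ifs; exacts [hG _ _, le_rfl]) (Finset.mem_univ x)
        rw [if_pos ⟨rfl, rfl⟩] at h1
        exact h1.trans h2
      have : G x y = 0 := le_antisymm (h0 ▸ hle) (hG x y)
      simp [this]
    · field_simp
  simp only [hstep, hstep']
  -- exchange the two copies of `x`
  have hcomm : ∀ F : X → Y → X → Y → ℝ,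
      ∑ x, ∑ y, ∑ x', ∑ y', F x y x' y' = ∑ x, ∑ y, ∑ x', ∑ y', F x' y x y' := by
    intro F
    calc ∑ x, ∑ y, ∑ x', ∑ y', F x y x' y' = ∑ x, ∑ x', ∑ y, ∑ y', F x y x' y' :=
          Finset.sum_congr rfl fun x _ => Finset.sum_comm
      _ = ∑ x', ∑ x, ∑ y, ∑ y', F x y x' y' := Finset.sum_comm
      _ = ∑ x', ∑ y, ∑ x, ∑ y', F x y x' y' := Finset.sum_congr rfl fun x _ => Finset.sum_comm
  rw [hcomm]
  refine Finset.sum_congr rfl fun x _ => Finset.sum_congr rfl fun y _ =>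
    Finset.sum_congr rfl fun x' _ => Finset.sum_congr rfl fun y' _ => ?_
  by_cases h : u x = u x' ∧ w y = w y'
  · rw [if_pos h, if_pos ⟨h.1.symm, h.2⟩, hφ _ _ y h.1, hDc _ _ y h.1, hm x y y']
    -- `φ` and `D` are constant in `x` on a class and `m` ignores `y`, so the exchanged summands
    -- differ only in the products of weights, which the cross identity equates.
    have := hcross x x' y y' h.1 h.2
    linear_combination -(m x y' * (φ x' y / D x' y)) * this
  · rw [if_neg h, if_neg fun h' => h ⟨h'.1.symm, h'.2⟩]

theorem sum_condMean_right {G m φ : X → Y → ℝ} {u : X → U} {w : Y → W} (hG : ∀ x y, 0 ≤ G x y)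
    (hcross : ∀ x x' y y', u x = u x' → w y = w y' → G x y * G x' y' = G x' y * G x y')
    (hm : ∀ x x' y, m x y = m x' y) (hφ : ∀ x y y', w y = w y' → φ x y = φ x y') :
    ∑ x, ∑ y, G x y * condMean G m u w x y * φ x y = ∑ x, ∑ y, G x y * m x y * φ x y := by
  have h := sum_condMean_left (G := fun y x => G x y) (m := fun y x => m x y)
    (φ := fun y x => φ x y) (u := w) (w := u) (fun y x => hG x y)
    (fun y y' x x' h1 h2 => by rw [hcross x x' y y' h2 h1]; ring) (fun y x x' => hm x x' y)
    (fun y y' x h => hφ x y y' h)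
  simp only [condMean_swap] at h
  rw [Finset.sum_comm, h, Finset.sum_comm]

end CondExp

/-! ### Resampling, threshold couplings and random hashing. -/

/-- Resampling one coordinate of a product distribution does not change it. -/
theorem sum_prod_update {Z : Type*} [Fintype Z] {n : ℕ} {μ : Z → ℝ} (hμ : ∑ z, μ z = 1) (j : Fin n)
    (F : (Fin n → Z) → ℝ) :
    ∑ z : Fin n → Z, ∑ c, (∏ i, μ (z i)) * μ c * F (Function.update z j c) =
      ∑ z : Fin n → Z, (∏ i, μ (z i)) * F z := by
  have hprod : ∀ (z : Fin n → Z) c, (∏ i, μ (Function.update z j c i)) * μ (z j) =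
      (∏ i, μ (z i)) * μ c := by
    intro z c
    rw [← Finset.mul_prod_erase _ _ (Finset.mem_univ j),
      ← Finset.mul_prod_erase _ (fun i => μ (z i)) (Finset.mem_univ j)]
    have : ∏ i ∈ Finset.univ.erase j, μ (Function.update z j c i) =
        ∏ i ∈ Finset.univ.erase j, μ (z i) :=
      Finset.prod_congr rfl fun i hi => by
        rw [Function.update_of_ne (Finset.ne_of_mem_erase hi)]
    rw [this, Function.update_self]; ring
  -- Swapping `z j` with the fresh sample is an involution that preserves the product weight.
  let e : (Fin n → Z) × Z ≃ (Fin n → Z) × Z :=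
    { toFun := fun p => (Function.update p.1 j p.2, p.1 j)
      invFun := fun p => (Function.update p.1 j p.2, p.1 j)
      left_inv := fun p => by simp
      right_inv := fun p => by simp }
  rw [← Fintype.sum_prod_type' (f := fun (z : Fin n → Z) c =>
    (∏ i, μ (z i)) * μ c * F (Function.update z j c))]
  rw [← e.sum_comp, Fintype.sum_prod_type]
  refine Finset.sum_congr rfl fun z _ => ?_
  have : ∀ c, (∏ i, μ ((e (z, c)).1 i)) * μ (e (z, c)).2 *
      F (Function.update (e (z, c)).1 j (e (z, c)).2) = (∏ i, μ (z i)) * F z * μ c := by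
    intro c
    simp only [e, Equiv.coe_fn_mk, hprod, Function.update_idem, Function.update_eq_self]
    ring
  simp only [this, ← Finset.mul_sum, hμ, mul_one]

/-- Finitely many numbers `p ∈ [0, 1]` can be realised simultaneously as probabilities of events
such that the symmetric differences have the smallest possible probabilities. -/
theorem exists_bernoulli_coupling (S : Finset ℝ) (hS : ∀ p ∈ S, p ∈ Set.Icc (0 : ℝ) 1) :
    ∃ (Θ : Type) (_ : Fintype Θ) (w : Θ → ℝ) (s : Θ → ℝ → Bool), (∀ θ, 0 ≤ w θ) ∧ ∑ θ, w θ = 1 ∧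
      (∀ p ∈ S, ∑ θ, w θ * (if s θ p then 1 else 0) = p) ∧
      ∀ p ∈ S, ∀ q ∈ S, ∑ θ, w θ * (if s θ p ≠ s θ q then 1 else 0) = |p - q| := by
  classical
  -- One uniform threshold `r` serves all `p`: the events for `p` and `q` differ exactly when `r`
  -- falls between them. Only the pattern on `S` matters, which makes the probability space finite.
  let σ : ℝ → S → Bool := fun r p => decide (r < p)
  let ν : MeasureTheory.Measure ℝ := MeasureTheory.volume.restrict (Set.Ico 0 1)
  have hσ : Measurable σ := measurable_pi_iff.2 fun p =>
    measurable_to_bool (by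
      have : (fun r : ℝ => σ r p) ⁻¹' {true} = Set.Iio (p : ℝ) := by ext r; simp [σ]
      rw [this]; exact measurableSet_Iio)
  have hfin : MeasureTheory.IsFiniteMeasure ν := ⟨by simp [ν]⟩
  have key : ∀ (E : (S → Bool) → Prop) [DecidablePred E],
      ∑ θ, (ν.map σ).real {θ} * (if E θ then 1 else 0) = ν.real {r | E (σ r)} := by
    intro E _
    have h1 : ∑ θ, (ν.map σ).real {θ} * (if E θ then 1 else 0) =
        ∑ θ with E θ, (ν.map σ).real {θ} := by
      simp [Finset.sum_filter]
    rw [h1, MeasureTheory.sum_measureReal_singleton, MeasureTheory.measureReal_def,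
      MeasureTheory.Measure.map_apply hσ (Set.toFinite _).measurableSet,
      MeasureTheory.measureReal_def]
    congr 2
    ext r; simp
  have hIio : ∀ p ∈ Set.Icc (0 : ℝ) 1, ν.real {r | r < p} = p := by
    intro p hp
    have : Set.Iio p ∩ Set.Ico 0 1 = Set.Ico 0 p := by
      ext r; simp only [Set.mem_inter_iff, Set.mem_Iio, Set.mem_Ico]
      constructor
      · exact fun h => ⟨h.2.1, h.1⟩
      · exact fun h => ⟨h.2, h.1, h.2.trans_le hp.2⟩
    change (MeasureTheory.volume.restrict (Set.Ico 0 1)).real (Set.Iio p) = p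
    rw [MeasureTheory.measureReal_restrict_apply measurableSet_Iio, this]
    simp [hp.1]
  refine ⟨S → Bool, inferInstance, fun θ => (ν.map σ).real {θ},
    fun θ p => if h : p ∈ S then θ ⟨p, h⟩ else false, fun θ => MeasureTheory.measureReal_nonneg,
    ?_, ?_, ?_⟩
  · have := key fun _ => True
    simpa [ν] using this
  · intro p hp
    have := key fun θ => θ ⟨p, hp⟩ = true
    simp only [dif_pos hp]
    rw [this]
    simpa [σ] using hIio p (hS p hp)
  · have haux : ∀ (p : ℝ) (hp : p ∈ S) (q : ℝ) (hq : q ∈ S), p ≤ q →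
        ν.real {r | σ r ⟨p, hp⟩ ≠ σ r ⟨q, hq⟩} = q - p := by
      intro p hp q hq hpq
      have : {r | σ r ⟨p, hp⟩ ≠ σ r ⟨q, hq⟩} ∩ Set.Ico 0 1 = Set.Ico p q := by
        ext r
        simp only [σ, Set.mem_inter_iff, Set.mem_ofPred_eq, Set.mem_Ico, ne_eq, decide_eq_decide]
        have h0 := (hS p hp).1
        have h1 := (hS q hq).2
        constructor
        · rintro ⟨h, _⟩
          by_contra h'
          apply h
          constructor
          · intro h2; linarith
          · intro h2; by_contra h3; exact h' ⟨not_lt.1 h3, h2⟩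
        · rintro ⟨h2, h3⟩
          exact ⟨fun h => absurd (h.2 h3) (not_lt.2 h2), by linarith, by linarith⟩
      rw [MeasureTheory.measureReal_restrict_apply, this]
      · simp [hpq]
      · have h1 := (measurable_pi_iff.1 hσ) ⟨p, hp⟩
        have h2 := (measurable_pi_iff.1 hσ) ⟨q, hq⟩
        exact (measurableSet_eq_fun h1 h2).compl
    intro p hp q hq
    have := key fun θ => θ ⟨p, hp⟩ ≠ θ ⟨q, hq⟩
    simp only [dif_pos hp, dif_pos hq]
    rw [this]
    rcases le_total p q with h | h
    · rw [haux p hp q hq h, abs_sub_comm, abs_of_nonneg (sub_nonneg.2 h)]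
    · rw [abs_of_nonneg (sub_nonneg.2 h), ← haux q hq p hp h]
      simp only [ne_comm]

/-- Two distinct points collide under a uniformly random function to `T` with probability
`1 / |T|`. -/
theorem card_collision {D T : Type*} [Fintype D] [DecidableEq D] [Fintype T] [DecidableEq T]
    {p q : D} (hpq : p ≠ q) :
    ((Finset.univ.filter fun h : D → T => h p = h q).card : ℝ) * Fintype.card T =
      Fintype.card (D → T) := by
  -- A colliding function is determined by its values away from `p`, and these are arbitrary.
  have h1 : (Finset.univ.filter fun h : D → T => h p = h q).card =
      Fintype.card ({d // d ≠ p} → T) := by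
    rw [← Fintype.card_subtype]
    refine Fintype.card_congr
      { toFun := fun h d => h.1 d
        invFun := fun g => ⟨fun d => if hd : d = p then g ⟨q, hpq.symm⟩ else g ⟨d, hd⟩, ?_⟩
        left_inv := ?_
        right_inv := ?_ }
    · simp [hpq.symm]
    · rintro ⟨h, hh⟩
      ext d
      by_cases hd : d = p
      · subst hd; simp [hh]
      · simp [hd]
    · intro g
      ext ⟨d, hd⟩
      simp [hd]
  rw [h1, Fintype.card_congr (Equiv.funSplitAt p T), Fintype.card_prod]
  push_cast; ring

/-! ### Random paths with independent randomness at each level. -/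

section SampledPath

variable {Θ : Type*} {w : Θ → ℝ} {s : Θ → ℝ → Bool} {C : ℕ}

/-- The bit drawn after the history `v` with probability `q`, from the randomness of its level. -/
def sampledBit (s : Θ → ℝ → Bool) (ρ : Fin C → Θ) (v : List Bool) (q : ℝ) : Bool :=
  if h : v.length < C then s (ρ ⟨v.length, h⟩) q else false

/-- The probability of a history, when `p u` is the probability of the bit `true` after `u`. -/
def pathProb (p : List Bool → ℝ) : List Bool → ℝ
  | [] => 1
  | b :: v => pathProb p v * bif b then p v else 1 - p v

/-- The histories of length `t`. -/
noncomputable def historiesOfLength (t : ℕ) : Finset (List Bool) :=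
  (List.finite_length_eq Bool t).toFinset

theorem mem_historiesOfLength {t : ℕ} {v : List Bool} :
    v ∈ historiesOfLength t ↔ v.length = t := by
  simp [historiesOfLength]

theorem sum_historiesOfLength {t : ℕ} {v : List Bool} (hv : v.length = t) (F : List Bool → ℝ) :
    ∑ u ∈ historiesOfLength t, (if v = u then 1 else 0) * F u = F v := by
  simp [mem_historiesOfLength, hv]

theorem sampledPath_update (p : List Bool → ℝ) (ρ : Fin C → Θ) (j : Fin C) (θ : Θ) {t : ℕ}
    (ht : t ≤ j) :
    extendHistory (fun v => sampledBit s (Function.update ρ j θ) v (p v)) [] t =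
      extendHistory (fun v => sampledBit s ρ v (p v)) [] t := by
  apply extendHistory_eq_of_agree
  intro i hi
  unfold sampledBit
  split_ifs with h
  · rw [Function.update_of_ne]
    intro h'
    have h1 := congrArg Fin.val h'
    simp only [extendHistory_length, List.length_nil] at h1
    omega
  · rfl

variable [Fintype Θ]

/-- The first `j` bits use only levels below `j`, so they are independent of `ρ j`; resampling that
level makes this visible. -/
theorem sum_sampledPath_mul (hw : ∑ θ, w θ = 1) (p : List Bool → ℝ) (j : Fin C) (v : List Bool)
    (H : Θ → ℝ) :
    ∑ ρ : Fin C → Θ, (∏ i, w (ρ i)) *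
      ((if extendHistory (fun v => sampledBit s ρ v (p v)) [] j = v then 1 else 0) * H (ρ j)) =
    (∑ ρ : Fin C → Θ, (∏ i, w (ρ i)) *
      (if extendHistory (fun v => sampledBit s ρ v (p v)) [] j = v then 1 else 0)) *
        ∑ θ, w θ * H θ := by
  rw [← sum_prod_update hw j, Finset.sum_mul]
  refine Finset.sum_congr rfl fun ρ _ => ?_
  rw [Finset.mul_sum]
  refine Finset.sum_congr rfl fun θ _ => ?_
  rw [sampledPath_update p ρ j θ le_rfl, Function.update_self]
  ring

theorem sum_sampledPath_eq (hw : ∑ θ, w θ = 1) (p : List Bool → ℝ)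
    (hs : ∀ v : List Bool, v.length < C → ∑ θ, w θ * (if s θ (p v) then 1 else 0) = p v)
    (v : List Bool) (hv : v.length ≤ C) :
    ∑ ρ : Fin C → Θ, (∏ i, w (ρ i)) *
      (if extendHistory (fun v => sampledBit s ρ v (p v)) [] v.length = v then 1 else 0) =
        pathProb p v := by
  induction v with
  | nil => simp [extendHistory, pathProb, ← Fintype.prod_sum, hw]
  | cons b v ih =>
    have hlt : v.length < C := hv
    have h := sum_sampledPath_mul (s := s) hw p ⟨v.length, hlt⟩ v
      fun θ => if s θ (p v) = b then 1 else 0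
    rw [ih hlt.le] at h
    have hb : ∑ θ, w θ * (if s θ (p v) = b then 1 else 0) = bif b then p v else 1 - p v := by
      cases b with
      | true => exact hs v hlt
      | false =>
        have h1 : ∑ θ, w θ * (if s θ (p v) = false then 1 else 0) =
            ∑ θ, w θ - ∑ θ, w θ * (if s θ (p v) then 1 else 0) := by
          rw [← Finset.sum_sub_distrib]
          refine Finset.sum_congr rfl fun θ _ => ?_
          cases s θ (p v) <;> simp
        rw [h1, hs v hlt, hw, cond_false]
    rw [hb] at h
    rw [pathProb, ← h]
    refine Finset.sum_congr rfl fun ρ _ => ?_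
    congr 1
    simp only [List.length_cons, extendHistory, List.cons.injEq]
    by_cases he : extendHistory (fun v => sampledBit s ρ v (p v)) [] v.length = v
    · have hbit : sampledBit s ρ v (p v) = s (ρ ⟨v.length, hlt⟩) (p v) := dif_pos hlt
      simp [he, hbit]
    · simp [he]

theorem sum_sampledPath (hw : ∑ θ, w θ = 1) (p : List Bool → ℝ)
    (hs : ∀ v : List Bool, v.length < C → ∑ θ, w θ * (if s θ (p v) then 1 else 0) = p v)
    {t : ℕ} (ht : t ≤ C) (F : List Bool → ℝ) :
    ∑ ρ : Fin C → Θ, (∏ i, w (ρ i)) *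
      F (extendHistory (fun v => sampledBit s ρ v (p v)) [] t) =
        ∑ v ∈ historiesOfLength t, pathProb p v * F v := by
  have h : ∀ v ∈ historiesOfLength t, pathProb p v * F v =
      ∑ ρ : Fin C → Θ, (∏ i, w (ρ i)) *
        ((if extendHistory (fun v => sampledBit s ρ v (p v)) [] t = v then 1 else 0) * F v) := by
    intro v hv
    rw [mem_historiesOfLength] at hv
    subst hv
    rw [← sum_sampledPath_eq hw p hs v ht, Finset.sum_mul]
    exact Finset.sum_congr rfl fun ρ _ => by ring
  rw [Finset.sum_congr rfl h, Finset.sum_comm]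
  refine Finset.sum_congr rfl fun ρ _ => ?_
  rw [← Finset.mul_sum, sum_historiesOfLength (by simp [extendHistory_length])]

/-- Used to evaluate the probability that the players' bits differ at step `j`, an event depending
on the history and on the fresh randomness `ρ j`. -/
theorem sum_sampledPath_step (hw : ∑ θ, w θ = 1) (p : List Bool → ℝ)
    (hs : ∀ v : List Bool, v.length < C → ∑ θ, w θ * (if s θ (p v) then 1 else 0) = p v)
    (j : Fin C) (H : List Bool → Θ → ℝ) :
    ∑ ρ : Fin C → Θ, (∏ i, w (ρ i)) *
      H (extendHistory (fun v => sampledBit s ρ v (p v)) [] j) (ρ j) =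
        ∑ v ∈ historiesOfLength j, pathProb p v * ∑ θ, w θ * H v θ := by
  have h : ∀ v ∈ historiesOfLength j, pathProb p v * ∑ θ, w θ * H v θ =
      ∑ ρ : Fin C → Θ, (∏ i, w (ρ i)) *
        ((if extendHistory (fun v => sampledBit s ρ v (p v)) [] j = v then 1 else 0) *
          H v (ρ j)) := by
    intro v hv
    rw [mem_historiesOfLength] at hv
    rw [sum_sampledPath_mul hw p j v (H v), ← hv,
      sum_sampledPath_eq hw p hs v (by rw [hv]; exact j.2.le)]
  rw [Finset.sum_congr rfl h, Finset.sum_comm]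
  refine Finset.sum_congr rfl fun ρ _ => ?_
  rw [← Finset.mul_sum]
  rw [sum_historiesOfLength (by simp [extendHistory_length]) fun v => H v (ρ j)]

end SampledPath

/-! ### Rectangles and the hybrid conditional means. -/

namespace CommProtocol

section Reaches

variable {X Y Z : Type*}

/-- The inputs `x`, `y` lead to the history `v`. -/
def Reaches (π : CommProtocol X Y Z) : List Bool → X → Y → Prop
  | [], _, _ => True
  | b :: v, x, y => π.Reaches v x y ∧ π.message v x y = b

theorem transcript_eq_iff (π : CommProtocol X Y Z) (v : List Bool) (x : X) (y : Y) :
    π.transcript x y v.length = v ↔ π.Reaches v x y := by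
  induction v with
  | nil => simp [transcript, extendHistory, Reaches]
  | cons b v ih =>
    rw [Reaches, ← ih]
    simp only [transcript, List.length_cons, extendHistory, List.cons.injEq]
    constructor
    · rintro ⟨h1, h2⟩; rw [h2] at h1; exact ⟨h2, h1⟩
    · rintro ⟨h1, h2⟩; rw [h1]; exact ⟨h2, rfl⟩

/-- The rectangle property: each bit of `v` tests only its owner's input, and both inputs in the
mixed pair pass their tests. -/
theorem Reaches.cross {π : CommProtocol X Y Z} {v : List Bool} {x x' : X} {y y' : Y}
    (h : π.Reaches v x y) (h' : π.Reaches v x' y') : π.Reaches v x' y := by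
  induction v with
  | nil => trivial
  | cons b v ih =>
    refine ⟨ih h.1 h'.1, ?_⟩
    cases ho : (π.subtree v).aliceOwned with
    | true => rw [message_eq_of_alice ho x' y y']; exact h'.2
    | false => rw [message_eq_of_bob ho x' x y]; exact h.2

end Reaches

section Information

variable {X Y Z : Type*} {n : ℕ}

theorem powDist_cross (μ : X × Y → ℝ) {k : ℕ} {x x' : Fin n → X} {y y' : Fin n → Y}
    (hx : ∀ i : Fin n, (i : ℕ) < k → x i = x' i) (hy : ∀ i : Fin n, k ≤ (i : ℕ) → y i = y' i) :
    powDist μ n (x, y) * powDist μ n (x', y') = powDist μ n (x', y) * powDist μ n (x, y') := by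
  simp only [powDist, ← Finset.prod_mul_distrib]
  refine Finset.prod_congr rfl fun i _ => ?_
  rcases Nat.lt_or_ge i k with h | h
  · rw [hx i h]
  · rw [hy i h]; ring

open Classical in
/-- The probability of the inputs `x`, `y`, if they lead to the history `v`, and `0` otherwise. -/
noncomputable def historyWeight (π : CommProtocol (Fin n → X) (Fin n → Y) Z) (μ : X × Y → ℝ)
    (v : List Bool) (x : Fin n → X) (y : Fin n → Y) : ℝ :=
  powDist μ n (x, y) * if π.Reaches v x y then 1 else 0

variable {π : CommProtocol (Fin n → X) (Fin n → Y) Z} {μ : X × Y → ℝ}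

theorem powDist_nonneg (hμ : ∀ p, 0 ≤ μ p) (p : (Fin n → X) × (Fin n → Y)) :
    0 ≤ powDist μ n p := Finset.prod_nonneg fun _ _ => hμ _

theorem historyWeight_nonneg (hμ : ∀ p, 0 ≤ μ p) (v : List Bool) (x : Fin n → X)
    (y : Fin n → Y) : 0 ≤ π.historyWeight μ v x y :=
  mul_nonneg (powDist_nonneg hμ _) (by split_ifs <;> norm_num)

/-- Factor by factor, either the `x`-coordinates or the `y`-coordinates coincide, and the event of
reaching `v` is a rectangle. In probabilistic terms: given `v`, `xᵢ` for `i < k` and `yᵢ` for `i ≥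
k`, the inputs `x` and `y` are independent. -/
theorem historyWeight_cross (v : List Bool) {k : ℕ} {x x' : Fin n → X} {y y' : Fin n → Y}
    (hx : ∀ i : Fin n, (i : ℕ) < k → x i = x' i) (hy : ∀ i : Fin n, k ≤ (i : ℕ) → y i = y' i) :
    π.historyWeight μ v x y * π.historyWeight μ v x' y' =
      π.historyWeight μ v x' y * π.historyWeight μ v x y' := by
  classical
  have h1 := powDist_cross μ hx hy
  have h2 : ((if π.Reaches v x y then 1 else 0) * (if π.Reaches v x' y' then 1 else 0) : ℝ) =
      (if π.Reaches v x' y then 1 else 0) * (if π.Reaches v x y' then 1 else 0) := by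
    have : (π.Reaches v x y ∧ π.Reaches v x' y') ↔ (π.Reaches v x' y ∧ π.Reaches v x y') :=
      ⟨fun h => ⟨h.1.cross h.2, h.2.cross h.1⟩, fun h => ⟨h.1.cross h.2, h.2.cross h.1⟩⟩
    simp only [← ite_and, mul_ite, mul_one, mul_zero]
    split_ifs <;> simp_all
  unfold historyWeight
  rw [mul_mul_mul_comm, h1, h2, mul_mul_mul_comm]

variable [Fintype X] [Fintype Y]

/-- The probability of the bit `true` after the history `v`, given the inputs `xᵢ` for `i < k` and
`yᵢ` for `i ≥ k`. -/
noncomputable def bitMean (π : CommProtocol (Fin n → X) (Fin n → Y) Z) (μ : X × Y → ℝ) (k : ℕ)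
    (v : List Bool) (x : Fin n → X) (y : Fin n → Y) : ℝ :=
  condMean (π.historyWeight μ v) (fun x y => if π.message v x y then 1 else 0)
    (fun x (i : {i : Fin n // (i : ℕ) < k}) => x i) (fun y (i : {i : Fin n // k ≤ (i : ℕ)}) => y i)
    x y

theorem bitMean_congr {k : ℕ} (v : List Bool) {x x' : Fin n → X} {y y' : Fin n → Y}
    (hx : ∀ i : Fin n, (i : ℕ) < k → x i = x' i) (hy : ∀ i : Fin n, k ≤ (i : ℕ) → y i = y' i) :
    π.bitMean μ k v x y = π.bitMean μ k v x' y' :=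
  condMean_congr _ _ (funext fun i => hx i i.2) (funext fun i => hy i i.2)

theorem bitMean_mem_Icc (hμ : ∀ p, 0 ≤ μ p) (k : ℕ) (v : List Bool) (x : Fin n → X)
    (y : Fin n → Y) : π.bitMean μ k v x y ∈ Set.Icc (0 : ℝ) 1 :=
  condMean_mem_Icc (historyWeight_nonneg hμ v)
    (fun x y => by split_ifs <;> simp) _ _ x y

/-- By conditional independence, also revealing the rest of `y` does not change the mean of Alice's
bit. This is why the test function may depend on all of `y`. -/
theorem sum_bitMean_alice (hμ : ∀ p, 0 ≤ μ p) {v : List Bool}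
    (hv : (π.subtree v).aliceOwned = true) (k : ℕ) {φ : (Fin n → X) → (Fin n → Y) → ℝ}
    (hφ : ∀ x x' y, (∀ i : Fin n, (i : ℕ) < k → x i = x' i) → φ x y = φ x' y) :
    ∑ x, ∑ y, π.historyWeight μ v x y * π.bitMean μ k v x y * φ x y =
      ∑ x, ∑ y, π.historyWeight μ v x y * (if π.message v x y then 1 else 0) * φ x y :=
  sum_condMean_left (historyWeight_nonneg hμ v)
    (fun x x' y y' hx hy => historyWeight_cross v (fun i hi => congrFun hx ⟨i, hi⟩)
      fun i hi => congrFun hy ⟨i, hi⟩)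
    (fun x y y' => by rw [message_eq_of_alice hv x y y'])
    fun x x' y h => hφ x x' y fun i hi => congrFun h ⟨i, hi⟩

theorem sum_bitMean_bob (hμ : ∀ p, 0 ≤ μ p) {v : List Bool}
    (hv : (π.subtree v).aliceOwned = false) (k : ℕ) {φ : (Fin n → X) → (Fin n → Y) → ℝ}
    (hφ : ∀ x y y', (∀ i : Fin n, k ≤ (i : ℕ) → y i = y' i) → φ x y = φ x y') :
    ∑ x, ∑ y, π.historyWeight μ v x y * π.bitMean μ k v x y * φ x y =
      ∑ x, ∑ y, π.historyWeight μ v x y * (if π.message v x y then 1 else 0) * φ x y :=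
  sum_condMean_right (historyWeight_nonneg hμ v)
    (fun x x' y y' hx hy => historyWeight_cross v (fun i hi => congrFun hx ⟨i, hi⟩)
      fun i hi => congrFun hy ⟨i, hi⟩)
    (fun x x' y => by rw [message_eq_of_bob hv x x' y])
    fun x y y' h => hφ x y y' fun i hi => congrFun h ⟨i, hi⟩

/-- At Alice's nodes the means form a martingale as `k` grows, at Bob's as `k` decreases. Increments
are therefore orthogonal to the less informed mean, second moments telescope, and they lie between
`0` and the total mass. -/
theorem sum_sq_bitMean_le (hμ : ∀ p, 0 ≤ μ p) (v : List Bool) :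
    ∑ k ∈ Finset.range n, ∑ x, ∑ y, π.historyWeight μ v x y *
      (π.bitMean μ (k + 1) v x y - π.bitMean μ k v x y) ^ 2 ≤
        ∑ x, ∑ y, π.historyWeight μ v x y := by
  set S : ℕ → ℝ := fun k => ∑ x, ∑ y, π.historyWeight μ v x y * π.bitMean μ k v x y ^ 2 with hS
  have hS0 : ∀ k, 0 ≤ S k := fun k => Finset.sum_nonneg fun x _ => Finset.sum_nonneg fun y _ =>
    mul_nonneg (historyWeight_nonneg hμ v x y) (sq_nonneg _)
  have hS1 : ∀ k, S k ≤ ∑ x, ∑ y, π.historyWeight μ v x y := fun k =>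
    Finset.sum_le_sum fun x _ => Finset.sum_le_sum fun y _ =>
      mul_le_of_le_one_right (historyWeight_nonneg hμ v x y)
        (pow_le_one₀ (bitMean_mem_Icc hμ k v x y).1 (bitMean_mem_Icc hμ k v x y).2)
  have hexp : ∀ k l, ∑ x, ∑ y, π.historyWeight μ v x y *
      (π.bitMean μ k v x y - π.bitMean μ l v x y) ^ 2 = S k + S l -
        2 * ∑ x, ∑ y, π.historyWeight μ v x y * π.bitMean μ k v x y * π.bitMean μ l v x y := by
    intro k l
    simp only [hS, Finset.mul_sum, ← Finset.sum_add_distrib, ← Finset.sum_sub_distrib]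
    exact Finset.sum_congr rfl fun x _ => Finset.sum_congr rfl fun y _ => by ring
  have hsq : ∀ k, S k =
      ∑ x, ∑ y, π.historyWeight μ v x y * π.bitMean μ k v x y * π.bitMean μ k v x y := fun k =>
    Finset.sum_congr rfl fun x _ => Finset.sum_congr rfl fun y _ => by ring
  cases hv : (π.subtree v).aliceOwned with
  | true =>
    have hstep : ∀ k, ∑ x, ∑ y, π.historyWeight μ v x y *
        (π.bitMean μ (k + 1) v x y - π.bitMean μ k v x y) ^ 2 = S (k + 1) - S k := by
      intro k
      have h1 := sum_bitMean_alice (φ := π.bitMean μ k v) hμ hv (k + 1)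
        fun x x' y h => bitMean_congr v (fun i hi => h i (by omega)) fun _ _ => rfl
      have h2 := sum_bitMean_alice (φ := π.bitMean μ k v) hμ hv k
        fun x x' y h => bitMean_congr v h fun _ _ => rfl
      rw [hexp, h1, ← h2, ← hsq]; ring
    simp only [hstep, Finset.sum_range_sub]
    linarith [hS0 0, hS1 n]
  | false =>
    have hstep : ∀ k, ∑ x, ∑ y, π.historyWeight μ v x y *
        (π.bitMean μ (k + 1) v x y - π.bitMean μ k v x y) ^ 2 = -(S (k + 1) - S k) := by
      intro k
      have h1 := sum_bitMean_bob (φ := π.bitMean μ (k + 1) v) hμ hv k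
        fun x y y' h => bitMean_congr v (fun _ _ => rfl) fun i hi => h i (by omega)
      have h2 := sum_bitMean_bob (φ := π.bitMean μ (k + 1) v) hμ hv (k + 1)
        fun x y y' h => bitMean_congr v (fun _ _ => rfl) h
      have h3 : ∑ x, ∑ y, π.historyWeight μ v x y * π.bitMean μ (k + 1) v x y *
          π.bitMean μ k v x y = ∑ x, ∑ y, π.historyWeight μ v x y * π.bitMean μ k v x y *
          π.bitMean μ (k + 1) v x y :=
        Finset.sum_congr rfl fun x _ => Finset.sum_congr rfl fun y _ => by ring
      rw [hexp, h3, h1, ← h2, ← hsq]; ring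
    simp only [hstep, Finset.sum_neg_distrib, Finset.sum_range_sub]
    linarith [hS0 n, hS1 0]

-- Every input pair reaches exactly one history of each length.
open Classical in
theorem sum_historyWeight (t : ℕ) (Φ : List Bool → (Fin n → X) → (Fin n → Y) → ℝ) :
    ∑ v ∈ historiesOfLength t, ∑ x, ∑ y, π.historyWeight μ v x y * Φ v x y =
      ∑ x, ∑ y, powDist μ n (x, y) * Φ (π.transcript x y t) x y := by
  rw [Finset.sum_comm]
  refine Finset.sum_congr rfl fun x _ => ?_
  rw [Finset.sum_comm]
  refine Finset.sum_congr rfl fun y _ => ?_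
  rw [← sum_historiesOfLength (v := π.transcript x y t) (t := t)
    (by simp [transcript, extendHistory_length]) fun v => Φ v x y, Finset.mul_sum]
  refine Finset.sum_congr rfl fun v hv => ?_
  rw [mem_historiesOfLength] at hv
  rw [historyWeight, mul_assoc]
  subst hv
  simp only [transcript_eq_iff]

/-- The probability of the bit `true` after the history `v` that its owner uses for the `j`-th
copy. -/
noncomputable def ownerMean (π : CommProtocol (Fin n → X) (Fin n → Y) Z) (μ : X × Y → ℝ) (j : ℕ)
    (x : Fin n → X) (y : Fin n → Y) (v : List Bool) : ℝ :=
  bif (π.subtree v).aliceOwned then π.bitMean μ (j + 1) v x y else π.bitMean μ j v x y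

theorem ownerMean_congr {j : ℕ} (v : List Bool) {x x' : Fin n → X} {y y' : Fin n → Y}
    (hx : ∀ i : Fin n, (i : ℕ) ≤ j → x i = x' i) (hy : ∀ i : Fin n, j ≤ (i : ℕ) → y i = y' i) :
    π.ownerMean μ j x y v = π.ownerMean μ j x' y' v := by
  unfold ownerMean
  rw [bitMean_congr (k := j + 1) v (fun i hi => hx i (by omega)) fun i hi => hy i (by omega),
    bitMean_congr (k := j) v (fun i hi => hx i (by omega)) fun i hi => hy i (by omega)]

theorem sum_ownerMean (hμ : ∀ p, 0 ≤ μ p) (v : List Bool) (j : ℕ)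
    {φ : (Fin n → X) → (Fin n → Y) → ℝ}
    (hφ : ∀ x x' y y', (∀ i : Fin n, (i : ℕ) ≤ j → x i = x' i) →
      (∀ i : Fin n, j ≤ (i : ℕ) → y i = y' i) → φ x y = φ x' y') :
    ∑ x, ∑ y, π.historyWeight μ v x y * π.ownerMean μ j x y v * φ x y =
      ∑ x, ∑ y, π.historyWeight μ v x y * (if π.message v x y then 1 else 0) * φ x y := by
  cases hv : (π.subtree v).aliceOwned with
  | true =>
    simp only [ownerMean, hv, cond_true]
    exact sum_bitMean_alice hμ hv (j + 1) fun x x' y h =>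
      hφ x x' y y (fun i hi => h i (by omega)) fun _ _ => rfl
  | false =>
    simp only [ownerMean, hv, cond_false]
    exact sum_bitMean_bob hμ hv j fun x y y' h => hφ x x y y' (fun _ _ => rfl) h

/-- By induction on the history: `sum_ownerMean` says that the owner's mean is still the correct one
when all of `xᵢ`, `i ≤ j`, and `yᵢ`, `i ≥ j`, are known, so multiplying by it produces the true
weight of the longer history. -/
theorem sum_pathProb (hμ : ∀ p, 0 ≤ μ p) (v : List Bool) (j : ℕ)
    {φ : (Fin n → X) → (Fin n → Y) → ℝ}
    (hφ : ∀ x x' y y', (∀ i : Fin n, (i : ℕ) ≤ j → x i = x' i) →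
      (∀ i : Fin n, j ≤ (i : ℕ) → y i = y' i) → φ x y = φ x' y') :
    ∑ x, ∑ y, powDist μ n (x, y) * (pathProb (π.ownerMean μ j x y) v * φ x y) =
      ∑ x, ∑ y, π.historyWeight μ v x y * φ x y := by
  induction v generalizing φ with
  | nil => simp [pathProb, historyWeight, Reaches]
  | cons b v ih =>
    have hb : ∀ x x' y y', (∀ i : Fin n, (i : ℕ) ≤ j → x i = x' i) →
        (∀ i : Fin n, j ≤ (i : ℕ) → y i = y' i) →
        (bif b then π.ownerMean μ j x y v else 1 - π.ownerMean μ j x y v) * φ x y =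
        (bif b then π.ownerMean μ j x' y' v else 1 - π.ownerMean μ j x' y' v) * φ x' y' := by
      intro x x' y y' hx hy
      rw [ownerMean_congr v hx hy, hφ x x' y y' hx hy]
    have h1 := ih hb
    have h2 := sum_ownerMean (π := π) hμ v j hφ
    calc _ = ∑ x, ∑ y, powDist μ n (x, y) * (pathProb (π.ownerMean μ j x y) v *
          ((bif b then π.ownerMean μ j x y v else 1 - π.ownerMean μ j x y v) * φ x y)) := by
          simp only [pathProb, mul_assoc]
      _ = ∑ x, ∑ y, π.historyWeight μ v x y *
          (if π.message v x y = b then 1 else 0) * φ x y := by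
          rw [h1]
          cases b with
          | true => simpa only [cond_true, mul_assoc] using h2
          | false =>
            have h3 : ∀ (c : (Fin n → X) → (Fin n → Y) → ℝ),
                ∑ x, ∑ y, π.historyWeight μ v x y * ((1 - c x y) * φ x y) =
                ∑ x, ∑ y, π.historyWeight μ v x y * φ x y -
                  ∑ x, ∑ y, π.historyWeight μ v x y * c x y * φ x y := by
              intro c
              simp only [← Finset.sum_sub_distrib]
              exact Finset.sum_congr rfl fun x _ => Finset.sum_congr rfl fun y _ => by ring
            simp only [cond_false]
            rw [h3, h2, ← h3]
            refine Finset.sum_congr rfl fun x _ => Finset.sum_congr rfl fun y _ => ?_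
            cases π.message v x y <;> simp
      _ = _ := by
          refine Finset.sum_congr rfl fun x _ => Finset.sum_congr rfl fun y _ => ?_
          simp only [historyWeight, Reaches]
          by_cases h : π.Reaches v x y <;> simp [h]

/-- The simulated history has the right joint law with the inputs of the `j`-th copy. -/
theorem sum_simulated (hμ : ∀ p, 0 ≤ μ p) (t j : ℕ)
    {Φ : List Bool → (Fin n → X) → (Fin n → Y) → ℝ}
    (hΦ : ∀ v x x' y y', (∀ i : Fin n, (i : ℕ) ≤ j → x i = x' i) →
      (∀ i : Fin n, j ≤ (i : ℕ) → y i = y' i) → Φ v x y = Φ v x' y') :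
    ∑ x, ∑ y, powDist μ n (x, y) *
      ∑ v ∈ historiesOfLength t, pathProb (π.ownerMean μ j x y) v * Φ v x y =
      ∑ x, ∑ y, powDist μ n (x, y) * Φ (π.transcript x y t) x y := by
  have h : ∀ v ∈ historiesOfLength t, ∑ x, ∑ y, π.historyWeight μ v x y * Φ v x y =
      ∑ x, ∑ y, powDist μ n (x, y) * (pathProb (π.ownerMean μ j x y) v * Φ v x y) :=
    fun v _ => (sum_pathProb hμ v j (hΦ v)).symm
  rw [← sum_historyWeight t Φ, Finset.sum_congr rfl h]
  symm
  rw [Finset.sum_comm]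
  refine Finset.sum_congr rfl fun x _ => ?_
  rw [Finset.sum_comm]
  exact Finset.sum_congr rfl fun y _ => by rw [Finset.mul_sum]

theorem sum_powDist_update (hμ : ∑ p, μ p = 1) (j : Fin n)
    (F : (Fin n → X) → (Fin n → Y) → ℝ) :
    ∑ x : Fin n → X, ∑ y : Fin n → Y, powDist μ n (x, y) *
      ∑ c, ∑ d, μ (c, d) * F (Function.update x j c) (Function.update y j d) =
      ∑ x, ∑ y, powDist μ n (x, y) * F x y := by
  have h := sum_prod_update hμ j fun z => F (fun i => (z i).1) fun i => (z i).2
  have e : ∀ H : (Fin n → X) → (Fin n → Y) → ℝ, ∑ x, ∑ y, H x y =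
      ∑ z : Fin n → X × Y, H (fun i => (z i).1) fun i => (z i).2 := by
    intro H
    rw [← Fintype.sum_prod_type',
      ← (Equiv.arrowProdEquivProdArrow (Fin n) (fun _ => X) fun _ => Y).sum_comp]
    rfl
  rw [e, e]
  simp only [powDist, Prod.mk.eta]
  rw [← h]
  refine Finset.sum_congr rfl fun z _ => ?_
  rw [Fintype.sum_prod_type, Finset.mul_sum]
  refine Finset.sum_congr rfl fun c _ => ?_
  rw [Finset.mul_sum]
  refine Finset.sum_congr rfl fun d _ => ?_
  have h1 : (fun i => (Function.update z j (c, d) i).1) =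
      Function.update (fun i => (z i).1) j c := by
    ext i; by_cases hi : i = j
    · subst hi; simp
    · simp [hi]
  have h2 : (fun i => (Function.update z j (c, d) i).2) =
      Function.update (fun i => (z i).2) j d := by
    ext i; by_cases hi : i = j
    · subst hi; simp
    · simp [hi]
  rw [h1, h2, mul_assoc]

theorem sum_powDist (hμ : ∑ p, μ p = 1) :
    ∑ x : Fin n → X, ∑ y : Fin n → Y, powDist μ n (x, y) = 1 := by
  rw [← Fintype.sum_prod_type',
    ← (Equiv.arrowProdEquivProdArrow (Fin n) (fun _ => X) fun _ => Y).sum_comp]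
  change ∑ z : Fin n → X × Y, ∏ i, μ (z i) = 1
  rw [← Fintype.prod_sum (f := fun (_ : Fin n) p => μ p)]
  simp [hμ]

/-- For each bit, `|d| ≤ (1 / √n + √n * d ^ 2) / 2` and the bound on squared increments give a sum
of at most `√n` over the `n` copies. Summing over `C` bits and averaging over the copies gives the
claim. -/
theorem exists_copy_sum_abs_le (hn : 0 < n) (hμ : μ ∈ stdSimplex ℝ (X × Y)) (C : ℕ) :
    ∃ j : Fin n, ∑ t ∈ Finset.range C, ∑ x, ∑ y, powDist μ n (x, y) *
      |π.bitMean μ (j + 1) (π.transcript x y t) x y - π.bitMean μ j (π.transcript x y t) x y| ≤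
        C / √n := by
  have hpos : (0 : ℝ) < n := by exact_mod_cast hn
  have hr : 0 < √(n : ℝ) := Real.sqrt_pos.2 hpos
  have hrr : √(n : ℝ) * √(n : ℝ) = n := Real.mul_self_sqrt hpos.le
  set B : ℕ → ℕ → ℝ := fun k t => ∑ x, ∑ y, powDist μ n (x, y) *
    (π.bitMean μ (k + 1) (π.transcript x y t) x y - π.bitMean μ k (π.transcript x y t) x y) ^ 2
  have hB : ∀ t, ∑ k ∈ Finset.range n, B k t ≤ 1 := by
    intro t
    have h1 : ∀ k, B k t = ∑ v ∈ historiesOfLength t, ∑ x, ∑ y, π.historyWeight μ v x y *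
        (π.bitMean μ (k + 1) v x y - π.bitMean μ k v x y) ^ 2 := fun k =>
      (sum_historyWeight (π := π) (μ := μ) t fun v x y =>
        (π.bitMean μ (k + 1) v x y - π.bitMean μ k v x y) ^ 2).symm
    have h2 := sum_historyWeight (π := π) (μ := μ) t fun _ _ _ => 1
    simp only [mul_one] at h2
    rw [Finset.sum_congr rfl fun k _ => h1 k, Finset.sum_comm]
    refine (Finset.sum_le_sum fun v _ => sum_sq_bitMean_le hμ.1 v).trans ?_
    rw [h2, sum_powDist hμ.2]
  have habs : ∀ k t, ∑ x, ∑ y, powDist μ n (x, y) *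
      |π.bitMean μ (k + 1) (π.transcript x y t) x y - π.bitMean μ k (π.transcript x y t) x y| ≤
        (1 / √n + √n * B k t) / 2 := by
    intro k t
    have h1 : (1 / √n + √n * B k t) / 2 = ∑ x, ∑ y, powDist μ n (x, y) * ((1 / √n + √n *
        (π.bitMean μ (k + 1) (π.transcript x y t) x y -
          π.bitMean μ k (π.transcript x y t) x y) ^ 2) / 2) := by
      have h2 : 1 / √(n : ℝ) = ∑ x, ∑ y, powDist μ n (x, y) * (1 / √n) := by
        simp only [← Finset.sum_mul, sum_powDist hμ.2, one_mul]
      rw [h2]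
      simp only [B, Finset.mul_sum, ← Finset.sum_add_distrib, Finset.sum_div]
      exact Finset.sum_congr rfl fun x _ => Finset.sum_congr rfl fun y _ => by
        simp only [← Finset.sum_mul, sum_powDist hμ.2, one_mul]; ring
    rw [h1]
    refine Finset.sum_le_sum fun x _ => Finset.sum_le_sum fun y _ =>
      mul_le_mul_of_nonneg_left ?_ (powDist_nonneg hμ.1 _)
    set d := π.bitMean μ (k + 1) (π.transcript x y t) x y -
      π.bitMean μ k (π.transcript x y t) x y
    have h3 : 0 ≤ (√(n : ℝ) * |d| - 1) ^ 2 / √n := by positivity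
    have h4 : (√(n : ℝ) * |d| - 1) ^ 2 / √n = √n * d ^ 2 + 1 / √n - 2 * |d| := by
      rw [← sq_abs d]; field_simp; ring
    linarith
  obtain ⟨j, -, hj⟩ := Finset.exists_le_of_sum_le (s := (Finset.univ : Finset (Fin n)))
    (f := fun j : Fin n => ∑ t ∈ Finset.range C, ∑ x, ∑ y, powDist μ n (x, y) *
      |π.bitMean μ (j + 1) (π.transcript x y t) x y - π.bitMean μ j (π.transcript x y t) x y|)
    (g := fun _ => (C / √n : ℝ)) ⟨⟨0, hn⟩, Finset.mem_univ _⟩ (by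
      rw [Finset.sum_comm]
      have h1 : ∀ t ∈ Finset.range C, ∑ j : Fin n, ∑ x, ∑ y, powDist μ n (x, y) *
          |π.bitMean μ (j + 1) (π.transcript x y t) x y -
            π.bitMean μ j (π.transcript x y t) x y| ≤ √n := by
        intro t _
        calc _ ≤ ∑ j : Fin n, (1 / √n + √n * B j t) / 2 :=
              Finset.sum_le_sum fun j _ => habs j t
          _ = (n * (1 / √n) + √n * ∑ k ∈ Finset.range n, B k t) / 2 := by
              rw [← Finset.sum_div, Finset.sum_add_distrib, ← Finset.mul_sum,
                Finset.sum_range fun k => B k t]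
              simp
          _ ≤ (√n + √n * 1) / 2 := by
              have : (n : ℝ) * (1 / √n) = √n := by rw [mul_one_div, div_eq_iff hr.ne', hrr]
              rw [this]
              gcongr
              exact hB t
          _ = √n := by ring
      refine (Finset.sum_le_sum h1).trans (le_of_eq ?_)
      simp only [Finset.sum_const, Finset.card_range, Finset.card_univ, Fintype.card_fin,
        nsmul_eq_mul]
      rw [mul_div_assoc', eq_div_iff hr.ne', mul_assoc, hrr]; ring)
  exact ⟨j, hj⟩

end Information

end CommProtocol

/-! ### Averaging, and embedding a single input into a public sample. -/

theorem exists_le_of_weighted_sum_le {ι : Type*} [Fintype ι] {w F : ι → ℝ} {B : ℝ}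
    (hw : ∀ i, 0 ≤ w i) (hw1 : ∑ i, w i = 1) (h : ∑ i, w i * F i ≤ B) : ∃ i, F i ≤ B := by
  by_contra! hF
  obtain ⟨i, hi⟩ : ∃ i, w i ≠ 0 := by
    by_contra! h0
    simp [h0] at hw1
  have h1 : ∑ i, w i * B < ∑ i, w i * F i :=
    Finset.sum_lt_sum (fun i _ => mul_le_mul_of_nonneg_left (hF i).le (hw i))
      ⟨i, Finset.mem_univ i, mul_lt_mul_of_pos_left (hF i) ((hw i).lt_of_ne' hi)⟩
  rw [← Finset.sum_mul, hw1, one_mul] at h1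
  exact absurd h (not_le.2 h1)

theorem eventProb_eq_sum {Ω : Type*} [Fintype Ω] (μ : Ω → ℝ) (E : Ω → Prop) [DecidablePred E] :
    eventProb μ E = ∑ ω, μ ω * if E ω then 1 else 0 := by
  classical
  unfold eventProb
  rw [Finset.sum_filter]
  refine Finset.sum_congr rfl fun ω _ => ?_
  by_cases h : E ω <;> simp [h]

namespace CommProtocol

section Coupling

universe u v

variable {X : Type u} {Y : Type v} [Fintype X] [Fintype Y] {n : ℕ}

/-- A low-error protocol for `n` copies yields, for one of the copies, correlated bit choices of
the two players whose joint path computes `f` with small error, and which seldom disagree along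
this path. -/
theorem exists_coupled_simulation (hn : 0 < n) {μ : X × Y → ℝ} (hμ : μ ∈ stdSimplex ℝ (X × Y))
    (f : X → Y → Bool) {ε : ℝ} (π : CommProtocol (Fin n → X) (Fin n → Y) (Fin n → Bool))
    (hπ : ∀ i : Fin n, eventProb (powDist μ n)
      (fun p => π.run p.1 p.2 i ≠ f (p.1 i) (p.2 i)) ≤ ε) :
    ∃ (j : Fin n) (Θ : Type max u v) (_ : Fintype Θ) (w : Θ → ℝ) (a : Θ → X → List Bool → Bool)
      (b : Θ → Y → List Bool → Bool), (∀ θ, 0 ≤ w θ) ∧ ∑ θ, w θ = 1 ∧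
      (∑ θ, w θ * ∑ x, ∑ y, μ (x, y) * (if (π.subtree (extendHistory
        (ownerBit (fun v => (π.subtree v).aliceOwned) (a θ x) (b θ y)) [] π.cost)).leftLabel j ≠
          f x y then 1 else 0) ≤ ε) ∧
      ∑ θ, w θ * ∑ x, ∑ y, μ (x, y) * (((Finset.range π.cost).filter fun t =>
        a θ x (extendHistory (ownerBit (fun v => (π.subtree v).aliceOwned) (a θ x) (b θ y)) [] t) ≠
        b θ y (extendHistory (ownerBit (fun v => (π.subtree v).aliceOwned)
          (a θ x) (b θ y)) [] t)).card : ℝ) ≤ π.cost / √n := by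
  classical
  set C := π.cost
  set own : List Bool → Bool := fun v => (π.subtree v).aliceOwned
  obtain ⟨j, hj⟩ := exists_copy_sum_abs_le (π := π) hn hμ C
  -- Only finitely many means occur before depth `C`, so one finite coupling handles them all.
  let S : Finset ℝ := ((Finset.range (n + 1)) ×ˢ (List.finite_length_lt Bool C).toFinset ×ˢ
    (Finset.univ : Finset ((Fin n → X) × (Fin n → Y)))).image fun q =>
      π.bitMean μ q.1 q.2.1 q.2.2.1 q.2.2.2
  have hS : ∀ p ∈ S, p ∈ Set.Icc (0 : ℝ) 1 := by
    intro p hp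
    obtain ⟨q, -, rfl⟩ := Finset.mem_image.1 hp
    exact bitMean_mem_Icc hμ.1 _ _ _ _
  have hmem : ∀ k ≤ n, ∀ v : List Bool, v.length < C → ∀ x y, π.bitMean μ k v x y ∈ S := by
    intro k hk v hv x y
    refine Finset.mem_image.2 ⟨(k, v, x, y), ?_, rfl⟩
    simp [hv]; omega
  obtain ⟨Θ, _, w, s, hw0, hw1, hs, hs'⟩ := exists_bernoulli_coupling S hS
  let A : (Fin n → X) → (Fin n → Y) → (Fin C → Θ) → List Bool → Bool := fun x y ρ v =>
    sampledBit s ρ v (π.bitMean μ (j + 1) v x y)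
  let B : (Fin n → X) → (Fin n → Y) → (Fin C → Θ) → List Bool → Bool := fun x y ρ v =>
    sampledBit s ρ v (π.bitMean μ j v x y)
  -- `bitMean (j + 1)` ignores `y j`, so Alice may use the public sample's value there; likewise
  -- Bob, whose `bitMean j` ignores `x j`.
  have hAupd : ∀ x y c d ρ,
      A (Function.update x j c) y ρ = A (Function.update x j c) (Function.update y j d) ρ := by
    intro x y c d ρ
    funext v
    simp only [A]
    rw [bitMean_congr v (fun _ _ => rfl) fun i hi => ?_]
    rw [Function.update_of_ne]
    rintro rfl
    omega
  have hBupd : ∀ x y c d ρ,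
      B x (Function.update y j d) ρ = B (Function.update x j c) (Function.update y j d) ρ := by
    intro x y c d ρ
    funext v
    simp only [B]
    rw [bitMean_congr v (fun i hi => ?_) fun _ _ => rfl]
    rw [Function.update_of_ne]
    rintro rfl
    omega
  have hAB : ∀ x y ρ, ownerBit own (A x y ρ) (B x y ρ) =
      fun v => sampledBit s ρ v (π.ownerMean μ j x y v) := by
    intro x y ρ
    funext v
    simp only [ownerBit, ownerMean, own, A, B]
    cases (π.subtree v).aliceOwned <;> rfl
  have hsown : ∀ x y, ∀ v : List Bool, v.length < C →
      ∑ θ, w θ * (if s θ (π.ownerMean μ j x y v) then 1 else 0) = π.ownerMean μ j x y v := by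
    intro x y v hv
    apply hs
    unfold ownerMean
    cases (π.subtree v).aliceOwned
    · exact hmem _ j.2.le v hv x y
    · exact hmem _ j.2 v hv x y
  -- A public sample with copy `j` replaced by the real input is again distributed as `μⁿ`.
  have hswap : ∀ Ψ : (List Bool → Bool) → (List Bool → Bool) → X → Y → ℝ,
      ∑ θ : ((Fin n → X) × (Fin n → Y)) × (Fin C → Θ), (powDist μ n θ.1 * ∏ i, w (θ.2 i)) *
        ∑ c, ∑ d, μ (c, d) * Ψ (A (Function.update θ.1.1 j c) θ.1.2 θ.2)
          (B θ.1.1 (Function.update θ.1.2 j d) θ.2) c d =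
      ∑ x, ∑ y, powDist μ n (x, y) * ∑ ρ : Fin C → Θ, (∏ i, w (ρ i)) *
        Ψ (A x y ρ) (B x y ρ) (x j) (y j) := by
    intro Ψ
    rw [← sum_powDist_update hμ.2 j, Fintype.sum_prod_type, Fintype.sum_prod_type]
    refine Finset.sum_congr rfl fun x _ => Finset.sum_congr rfl fun y _ => ?_
    simp only [mul_assoc, ← Finset.mul_sum]
    congr 1
    simp only [Finset.mul_sum]
    rw [Finset.sum_comm]
    refine Finset.sum_congr rfl fun c _ => ?_
    rw [Finset.sum_comm]
    refine Finset.sum_congr rfl fun d _ => Finset.sum_congr rfl fun ρ _ => ?_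
    rw [hAupd x y c d ρ, hBupd x y c d ρ, Function.update_self, Function.update_self]
    ring
  refine ⟨j, ((Fin n → X) × (Fin n → Y)) × (Fin C → Θ), inferInstance,
    fun θ => powDist μ n θ.1 * ∏ i, w (θ.2 i),
    fun θ c => A (Function.update θ.1.1 j c) θ.1.2 θ.2,
    fun θ d => B θ.1.1 (Function.update θ.1.2 j d) θ.2,
    fun θ => mul_nonneg (powDist_nonneg hμ.1 _) (Finset.prod_nonneg fun i _ => hw0 _), ?_, ?_, ?_⟩
  · rw [Fintype.sum_prod_type]
    simp only [← Finset.mul_sum]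
    rw [← Fintype.prod_sum (f := fun (_ : Fin C) θ => w θ)]
    simp only [hw1, Finset.prod_const_one, mul_one]
    rw [Fintype.sum_prod_type, sum_powDist hμ.2]
  · refine (le_of_eq ?_).trans (hπ j)
    rw [hswap fun α β c d => if (π.subtree (extendHistory (ownerBit own α β) [] C)).leftLabel j ≠
      f c d then 1 else 0, eventProb_eq_sum, Fintype.sum_prod_type]
    have h1 : ∀ x y, ∑ ρ : Fin C → Θ, (∏ i, w (ρ i)) * (if (π.subtree (extendHistory
        (ownerBit own (A x y ρ) (B x y ρ)) [] C)).leftLabel j ≠ f (x j) (y j) then 1 else 0 : ℝ) =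
        ∑ v ∈ historiesOfLength C, pathProb (π.ownerMean μ j x y) v *
          (if (π.subtree v).leftLabel j ≠ f (x j) (y j) then 1 else 0) := by
      intro x y
      simp only [hAB]
      exact sum_sampledPath (s := s) hw1 (π.ownerMean μ j x y) (hsown x y) le_rfl
        fun v => if (π.subtree v).leftLabel j ≠ f (x j) (y j) then 1 else 0
    simp only [h1]
    rw [sum_simulated (Φ := fun v x y => if (π.subtree v).leftLabel j ≠ f (x j) (y j) then 1 else 0)
      hμ.1 C j fun v x x' y y' hx hy => by rw [hx j le_rfl, hy j le_rfl]]
    refine Finset.sum_congr rfl fun x _ => Finset.sum_congr rfl fun y _ => ?_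
    rw [leftLabel_transcript π x y le_rfl]
  · refine (le_of_eq ?_).trans hj
    rw [hswap fun α β _ _ => (((Finset.range C).filter fun t =>
      α (extendHistory (ownerBit own α β) [] t) ≠
        β (extendHistory (ownerBit own α β) [] t)).card : ℝ)]
    have h1 : ∀ x y (t : Fin C), ∑ ρ : Fin C → Θ, (∏ i, w (ρ i)) *
        (if A x y ρ (extendHistory (ownerBit own (A x y ρ) (B x y ρ)) [] t) ≠
          B x y ρ (extendHistory (ownerBit own (A x y ρ) (B x y ρ)) [] t) then 1 else 0 : ℝ) =
        ∑ v ∈ historiesOfLength t, pathProb (π.ownerMean μ j x y) v *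
          |π.bitMean μ (j + 1) v x y - π.bitMean μ j v x y| := by
      intro x y t
      have h2 := sum_sampledPath_step (s := s) hw1 (π.ownerMean μ j x y) (hsown x y) t
        fun v θ => if s θ (π.bitMean μ (j + 1) v x y) ≠ s θ (π.bitMean μ j v x y) then 1 else 0
      have h3 : ∀ v ∈ historiesOfLength t, pathProb (π.ownerMean μ j x y) v *
          ∑ θ, w θ * (if s θ (π.bitMean μ (j + 1) v x y) ≠ s θ (π.bitMean μ j v x y)
            then 1 else 0) = pathProb (π.ownerMean μ j x y) v *
          |π.bitMean μ (j + 1) v x y - π.bitMean μ j v x y| := by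
        intro v hv
        have hv' : v.length < C := by rw [mem_historiesOfLength] at hv; rw [hv]; exact t.2
        rw [hs' _ (hmem _ j.2 v hv' x y) _ (hmem _ j.2.le v hv' x y)]
      rw [← Finset.sum_congr rfl h3, ← h2]
      refine Finset.sum_congr rfl fun ρ _ => ?_
      rw [hAB]
      have hbit : ∀ q, sampledBit s ρ
          (extendHistory (fun v => sampledBit s ρ v (π.ownerMean μ j x y v)) [] t) q =
          s (ρ t) q := by
        intro q
        have hl : (extendHistory (fun v => sampledBit s ρ v (π.ownerMean μ j x y v)) [] t).length =
            t := by simp [extendHistory_length]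
        unfold sampledBit at hl ⊢
        rw [dif_pos (by rw [hl]; exact t.2)]
        congr 2
        exact Fin.ext hl
      simp only [A, B, hbit]
    have h2 : ∀ x y, ∑ ρ : Fin C → Θ, (∏ i, w (ρ i)) * (((Finset.range C).filter fun t =>
        A x y ρ (extendHistory (ownerBit own (A x y ρ) (B x y ρ)) [] t) ≠
          B x y ρ (extendHistory (ownerBit own (A x y ρ) (B x y ρ)) [] t)).card : ℝ) =
        ∑ t ∈ Finset.range C, ∑ v ∈ historiesOfLength t, pathProb (π.ownerMean μ j x y) v *
          |π.bitMean μ (j + 1) v x y - π.bitMean μ j v x y| := by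
      intro x y
      rw [Finset.sum_range]
      simp only [← h1]
      rw [Finset.sum_comm]
      refine Finset.sum_congr rfl fun ρ _ => ?_
      rw [← Finset.mul_sum, Finset.card_filter, Nat.cast_sum, Finset.sum_range]
      simp only [Nat.cast_ite, Nat.cast_one, Nat.cast_zero]
    simp only [h2, Finset.mul_sum (s := Finset.range C)]
    have h3 : ∀ t, ∑ x, ∑ y, powDist μ n (x, y) *
        ∑ v ∈ historiesOfLength t, pathProb (π.ownerMean μ j x y) v *
          |π.bitMean μ (j + 1) v x y - π.bitMean μ j v x y| = _ := fun t =>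
      sum_simulated (Φ := fun v x y => |π.bitMean μ (j + 1) v x y - π.bitMean μ j v x y|) hμ.1 t j
        fun v x x' y y' hx hy => by
          rw [bitMean_congr (k := j + 1) v (fun i hi => hx i (by omega)) fun i hi =>
            hy i (by omega), bitMean_congr (k := j) v (fun i hi => hx i (by omega)) fun i hi =>
            hy i (by omega)]
    rw [← Finset.sum_congr rfl fun t _ => h3 t]
    symm
    rw [Finset.sum_comm]
    refine Finset.sum_congr rfl fun x _ => ?_
    rw [Finset.sum_comm]

end Coupling

/-! ### Compression to a deterministic protocol for one copy. -/

section Compression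

variable {X Y : Type*} [Fintype X] [Fintype Y]

/-- Extension by a constant of a function on short lists. -/
def extendHash {s N : ℕ} (h : {l : List Bool // l.length ≤ N} → Fin s → Bool) (l : List Bool) :
    Fin s → Bool :=
  if hl : l.length ≤ N then h ⟨l, hl⟩ else fun _ => false

/-- The simulation errs only if the joint path has a wrong label, if it meets at least `K + 1`
disagreements (Markov), or if some hash comparison collides (union bound over `(C + 1) ^ 2` pairs).
Some choice of the randomness and the hash does as well as the average. -/
theorem exists_simulating_protocol {μ : X × Y → ℝ} (hμ : μ ∈ stdSimplex ℝ (X × Y))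
    (f : X → Y → Bool) {ε M : ℝ} {Θ : Type*} [Fintype Θ] {w : Θ → ℝ} {own lab : List Bool → Bool}
    {a : Θ → X → List Bool → Bool} {b : Θ → Y → List Bool → Bool} {C K L s : ℕ}
    (hw0 : ∀ θ, 0 ≤ w θ) (hw1 : ∑ θ, w θ = 1)
    (hlab : ∀ c v, C ≤ v.length → lab (c :: v) = lab v)
    (herr : ∑ θ, w θ * ∑ x, ∑ y, μ (x, y) * (if lab (extendHistory
      (ownerBit own (a θ x) (b θ y)) [] C) ≠ f x y then 1 else 0) ≤ ε)
    (hmis : ∑ θ, w θ * ∑ x, ∑ y, μ (x, y) * (((Finset.range C).filter fun t =>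
        a θ x (extendHistory (ownerBit own (a θ x) (b θ y)) [] t) ≠
        b θ y (extendHistory (ownerBit own (a θ x) (b θ y)) [] t)).card : ℝ) ≤ M)
    (hL : ∀ i < L, 2 ^ i ≤ C) (hL' : C < 2 ^ L) :
    ∃ τ : CommProtocol X Y Bool, τ.cost ≤ K * (L * (s + 1) + 1) + 1 ∧
      eventProb μ (fun p => τ.run p.1 p.2 ≠ f p.1 p.2) ≤
        ε + M / (K + 1) + (C + 1) ^ 2 / 2 ^ s := by
  classical
  -- Relevant comparisons start at depth at most `C` and look at most `C` steps ahead.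
  have hfin : Finite {l : List Bool // l.length ≤ 2 * C} := List.finite_length_le Bool (2 * C)
  have : Fintype {l : List Bool // l.length ≤ 2 * C} := Fintype.ofFinite _
  let H := {l : List Bool // l.length ≤ 2 * C} → Fin s → Bool
  have hN : (0 : ℝ) < Fintype.card H := by exact_mod_cast Fintype.card_pos
  let τ : Θ × H → CommProtocol X Y Bool := fun q =>
    simulate (extendHash q.2) own (a q.1) (b q.1) lab C L K (fun _ => []) fun _ => []
  let T : Θ → X → Y → ℕ → List Bool := fun θ x y =>
    extendHistory (ownerBit own (a θ x) (b θ y)) []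
  let E : Θ → X → Y → ℝ := fun θ x y => if lab (T θ x y C) ≠ f x y then 1 else 0
  let D : Θ → X → Y → ℝ := fun θ x y => (((Finset.range C).filter fun t =>
    a θ x (T θ x y t) ≠ b θ y (T θ x y t)).card : ℝ)
  let G : Θ → H → X → Y → ℝ := fun θ h x y =>
    ∑ m ∈ Finset.range (C + 1), ∑ r ∈ Finset.range (C + 1),
      if extendHistory (a θ x) (T θ x y m) r ≠ extendHistory (b θ y) (T θ x y m) r ∧
        extendHash h (extendHistory (a θ x) (T θ x y m) r) =
          extendHash h (extendHistory (b θ y) (T θ x y m) r) then 1 else 0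
  have hpoint : ∀ θ h x y, (if (τ (θ, h)).run x y ≠ f x y then (1 : ℝ) else 0) ≤
      E θ x y + D θ x y / (K + 1) + G θ h x y := by
    intro θ h x y
    have hE : 0 ≤ E θ x y := by dsimp only [E]; split_ifs <;> norm_num
    have hD : 0 ≤ D θ x y / (K + 1) := by positivity
    have hG0 : ∀ m r, (0 : ℝ) ≤ if extendHistory (a θ x) (T θ x y m) r ≠
        extendHistory (b θ y) (T θ x y m) r ∧
        extendHash h (extendHistory (a θ x) (T θ x y m) r) =
          extendHash h (extendHistory (b θ y) (T θ x y m) r) then 1 else 0 := by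
      intro m r; split_ifs <;> norm_num
    have hG : 0 ≤ G θ h x y := Finset.sum_nonneg fun m _ => Finset.sum_nonneg fun r _ => hG0 m r
    split_ifs with hrun
    swap
    · positivity
    by_cases hgood : ∀ m ≤ C, ∀ r ≤ C, extendHash h (extendHistory (a θ x) (T θ x y m) r) =
        extendHash h (extendHistory (b θ y) (T θ x y m) r) →
        extendHistory (a θ x) (T θ x y m) r = extendHistory (b θ y) (T θ x y m) r
    · by_cases hK : ((Finset.range C).filter fun t =>
          a θ x (T θ x y t) ≠ b θ y (T θ x y t)).card ≤ K
      · have h1 := simulate_run (extendHash h) hlab (T θ x y) rfl hgood hL hL' K 0 (Nat.zero_le _)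
          (by rwa [← Finset.range_eq_Ico]) (fun _ => []) (fun _ => []) rfl rfl
        have h2 : lab (T θ x y C) ≠ f x y := by rw [← h1]; exact hrun
        have : E θ x y = 1 := if_pos h2
        linarith
      · have : 1 ≤ D θ x y / (K + 1) := by
          rw [one_le_div (by positivity)]
          dsimp only [D]
          exact_mod_cast Nat.lt_of_not_le hK
        linarith
    · push Not at hgood
      obtain ⟨m, hm, r, hr, h1, h2⟩ := hgood
      have h3 := Finset.single_le_sum (s := Finset.range (C + 1)) (fun r _ => hG0 m r)
        (Finset.mem_range.2 (Nat.lt_succ_of_le hr))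
      have h4 := Finset.single_le_sum (s := Finset.range (C + 1))
        (f := fun m => ∑ r ∈ Finset.range (C + 1),
          if extendHistory (a θ x) (T θ x y m) r ≠ extendHistory (b θ y) (T θ x y m) r ∧
            extendHash h (extendHistory (a θ x) (T θ x y m) r) =
              extendHash h (extendHistory (b θ y) (T θ x y m) r) then (1 : ℝ) else 0)
        (fun m _ => Finset.sum_nonneg fun r _ => hG0 m r)
        (Finset.mem_range.2 (Nat.lt_succ_of_le hm))
      rw [if_pos ⟨h2, h1⟩] at h3
      have h5 : 1 ≤ G θ h x y := h3.trans h4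
      linarith
  have hcoll : ∀ θ x y, ∑ h : H, 1 / (Fintype.card H : ℝ) * G θ h x y ≤
      (C + 1) ^ 2 / 2 ^ s := by
    intro θ x y
    have h1 : ∀ m ∈ Finset.range (C + 1), ∀ r ∈ Finset.range (C + 1),
        ∑ h : H, 1 / (Fintype.card H : ℝ) *
          (if extendHistory (a θ x) (T θ x y m) r ≠ extendHistory (b θ y) (T θ x y m) r ∧
            extendHash h (extendHistory (a θ x) (T θ x y m) r) =
              extendHash h (extendHistory (b θ y) (T θ x y m) r) then 1 else 0) ≤ 1 / 2 ^ s := by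
      intro m hm r hr
      rw [Finset.mem_range] at hm hr
      have hla : (extendHistory (a θ x) (T θ x y m) r).length ≤ 2 * C := by
        simp only [T, extendHistory_length, List.length_nil]; omega
      have hlb : (extendHistory (b θ y) (T θ x y m) r).length ≤ 2 * C := by
        simp only [T, extendHistory_length, List.length_nil]; omega
      by_cases hne : extendHistory (a θ x) (T θ x y m) r = extendHistory (b θ y) (T θ x y m) r
      · simp [hne]
      · have h2 := card_collision (T := Fin s → Bool)
          (p := (⟨_, hla⟩ : {l : List Bool // l.length ≤ 2 * C})) (q := ⟨_, hlb⟩)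
          fun h => hne (congrArg Subtype.val h)
        rw [← Finset.mul_sum]
        simp only [extendHash, dif_pos hla, dif_pos hlb, ne_eq, hne, not_false_eq_true, true_and]
        rw [Finset.sum_boole, one_div_mul_eq_div, div_le_div_iff₀ hN (by positivity), one_mul]
        refine le_of_eq (Eq.trans ?_ h2)
        simp only [Fintype.card_fun, Fintype.card_bool, Fintype.card_fin, Nat.cast_pow,
          Nat.cast_ofNat]
        congr!
    simp only [G, Finset.mul_sum]
    rw [Finset.sum_comm]
    calc _ ≤ ∑ m ∈ Finset.range (C + 1), ∑ r ∈ Finset.range (C + 1), (1 / 2 ^ s : ℝ) := by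
          refine Finset.sum_le_sum fun m hm => ?_
          rw [Finset.sum_comm]
          exact Finset.sum_le_sum fun r hr => h1 m hm r hr
      _ = (C + 1) ^ 2 / 2 ^ s := by
          simp only [Finset.sum_const, Finset.card_range, nsmul_eq_mul]
          push_cast; ring
  have hμ2 : ∑ x, ∑ y, μ (x, y) = 1 := by rw [← Fintype.sum_prod_type']; exact hμ.2
  obtain ⟨q, hq⟩ := exists_le_of_weighted_sum_le (ι := Θ × H)
    (w := fun q => w q.1 * (1 / Fintype.card H))
    (F := fun q => eventProb μ fun p => (τ q).run p.1 p.2 ≠ f p.1 p.2)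
    (B := ε + M / (K + 1) + (C + 1) ^ 2 / 2 ^ s)
    (fun q => mul_nonneg (hw0 _) (by positivity))
    (by
      rw [Fintype.sum_prod_type]
      simp only [Finset.sum_const, Finset.card_univ, nsmul_eq_mul]
      rw [← Finset.mul_sum, ← Finset.sum_mul, hw1]
      field_simp)
    (by
      rw [Fintype.sum_prod_type]
      have hθ : ∀ θ, ∑ h : H, w θ * (1 / Fintype.card H) *
          eventProb μ (fun p => (τ (θ, h)).run p.1 p.2 ≠ f p.1 p.2) ≤
          w θ * ∑ x, ∑ y, μ (x, y) * E θ x y + w θ * (∑ x, ∑ y, μ (x, y) * D θ x y) / (K + 1) +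
            w θ * ((C + 1) ^ 2 / 2 ^ s) := by
        intro θ
        have h1 : ∀ h : H, eventProb μ (fun p => (τ (θ, h)).run p.1 p.2 ≠ f p.1 p.2) ≤
            ∑ x, ∑ y, μ (x, y) * (E θ x y + D θ x y / (K + 1) + G θ h x y) := by
          intro h
          rw [eventProb_eq_sum, Fintype.sum_prod_type]
          exact Finset.sum_le_sum fun x _ => Finset.sum_le_sum fun y _ =>
            mul_le_mul_of_nonneg_left (hpoint θ h x y) (hμ.1 _)
        have h2 : ∑ h : H, 1 / (Fintype.card H : ℝ) * ∑ x, ∑ y, μ (x, y) *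
            (E θ x y + D θ x y / (K + 1) + G θ h x y) =
            ∑ x, ∑ y, μ (x, y) * (E θ x y + D θ x y / (K + 1) +
              ∑ h : H, 1 / (Fintype.card H : ℝ) * G θ h x y) := by
          simp only [Finset.mul_sum (s := (Finset.univ : Finset X)),
            Finset.mul_sum (s := (Finset.univ : Finset Y))]
          rw [Finset.sum_comm]
          refine Finset.sum_congr rfl fun x _ => ?_
          rw [Finset.sum_comm]
          refine Finset.sum_congr rfl fun y _ => ?_
          rw [mul_add, Finset.mul_sum]
          have : μ (x, y) * (E θ x y + D θ x y / (K + 1)) =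
              ∑ h : H, 1 / (Fintype.card H : ℝ) * (μ (x, y) * (E θ x y + D θ x y / (K + 1))) := by
            rw [Finset.sum_const, Finset.card_univ, nsmul_eq_mul]
            field_simp
          rw [this, ← Finset.sum_add_distrib]
          exact Finset.sum_congr rfl fun h _ => by ring
        have h3 : ∑ x, ∑ y, μ (x, y) * (E θ x y + D θ x y / (K + 1) +
              ∑ h : H, 1 / (Fintype.card H : ℝ) * G θ h x y) ≤
            ∑ x, ∑ y, μ (x, y) * (E θ x y + D θ x y / (K + 1) + (C + 1) ^ 2 / 2 ^ s) :=
          Finset.sum_le_sum fun x _ => Finset.sum_le_sum fun y _ =>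
            mul_le_mul_of_nonneg_left (by linarith [hcoll θ x y]) (hμ.1 _)
        have h4 : ∑ x, ∑ y, μ (x, y) * (E θ x y + D θ x y / (K + 1) + (C + 1) ^ 2 / 2 ^ s) =
            ∑ x, ∑ y, μ (x, y) * E θ x y + (∑ x, ∑ y, μ (x, y) * D θ x y) / (K + 1) +
              (C + 1) ^ 2 / 2 ^ s := by
          have h5 : ((C + 1) ^ 2 / 2 ^ s : ℝ) = ∑ x, ∑ y, μ (x, y) * ((C + 1) ^ 2 / 2 ^ s) := by
            simp only [← Finset.sum_mul, hμ2, one_mul]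
          conv_rhs => rw [h5]
          simp only [Finset.sum_div, ← Finset.sum_add_distrib]
          exact Finset.sum_congr rfl fun x _ => Finset.sum_congr rfl fun y _ => by ring
        calc _ ≤ ∑ h : H, w θ * (1 / Fintype.card H) *
              ∑ x, ∑ y, μ (x, y) * (E θ x y + D θ x y / (K + 1) + G θ h x y) :=
              Finset.sum_le_sum fun h _ => mul_le_mul_of_nonneg_left (h1 h)
                (mul_nonneg (hw0 _) (by positivity))
          _ = w θ * ∑ h : H, 1 / (Fintype.card H : ℝ) *
              ∑ x, ∑ y, μ (x, y) * (E θ x y + D θ x y / (K + 1) + G θ h x y) := by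
              rw [Finset.mul_sum]
              exact Finset.sum_congr rfl fun h _ => by ring
          _ ≤ w θ * (∑ x, ∑ y, μ (x, y) * E θ x y + (∑ x, ∑ y, μ (x, y) * D θ x y) / (K + 1) +
              (C + 1) ^ 2 / 2 ^ s) := by
              rw [h2, ← h4]
              exact mul_le_mul_of_nonneg_left h3 (hw0 θ)
          _ = _ := by ring
      refine (Finset.sum_le_sum fun θ _ => hθ θ).trans ?_
      rw [Finset.sum_add_distrib, Finset.sum_add_distrib, ← Finset.sum_mul, hw1, one_mul,
        ← Finset.sum_div]
      have : (0 : ℝ) < K + 1 := by positivity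
      gcongr)
  exact ⟨τ q, cost_simulate _ _ _ _ _ _ _ _ _ _, hq⟩

end Compression

end CommProtocol

/-! ### Attained infima and the nearly constant case. -/

namespace CommProtocol

section Constant

variable {X Y Z P Q : Type*}

/-- Alice holds both inputs and owns all nodes. -/
def merge (g : P → X) (h : P → Y) : CommProtocol X Y Z → CommProtocol P Q Z
  | output z => output z
  | alice m l r => alice (fun p => m (g p)) (l.merge g h) (r.merge g h)
  | bob m l r => alice (fun p => m (h p)) (l.merge g h) (r.merge g h)

theorem run_merge (g : P → X) (h : P → Y) (π : CommProtocol X Y Z) (p : P) (q : Q) :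
    (π.merge g h : CommProtocol P Q Z).run p q = π.run (g p) (h p) := by
  induction π with
  | output z => rfl
  | alice m l r hl hr => simp only [merge, run, hl, hr]
  | bob m l r hl hr => simp only [merge, run, hl, hr]

theorem cost_merge (g : P → X) (h : P → Y) (π : CommProtocol X Y Z) :
    (π.merge g h : CommProtocol P Q Z).cost = π.cost := by
  induction π with
  | output z => rfl
  | alice m l r hl hr => simp only [merge, cost, hl, hr]
  | bob m l r hl hr => simp only [merge, cost, hl, hr]

theorem exists_run_eq_of_mem (s : Finset X) (k : X → CommProtocol X Y Z)
    (k₀ : CommProtocol X Y Z) :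
    ∃ π : CommProtocol X Y Z, ∀ x ∈ s, ∀ y, π.run x y = (k x).run x y := by
  classical
  induction s using Finset.induction_on with
  | empty => exact ⟨k₀, by simp⟩
  | insert a s _ ih =>
    obtain ⟨π, hπ⟩ := ih
    refine ⟨alice (fun x => decide (x = a)) π (k a), fun x hx y => ?_⟩
    by_cases hxa : x = a
    · subst hxa; simp [run]
    · simp [run, hxa, hπ x ((Finset.mem_insert.1 hx).resolve_left hxa) y]

theorem exists_run_eq_of_mem' (s : Finset Y) (g : Y → Z) (z₀ : Z) :
    ∃ π : CommProtocol X Y Z, ∀ x, ∀ y ∈ s, π.run x y = g y := by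
  classical
  induction s using Finset.induction_on with
  | empty => exact ⟨output z₀, by simp⟩
  | insert a s _ ih =>
    obtain ⟨π, hπ⟩ := ih
    refine ⟨bob (fun y => decide (y = a)) π (output (g a)), fun x y hy => ?_⟩
    by_cases hya : y = a
    · subst hya; simp [run]
    · simp [run, hya, hπ x y ((Finset.mem_insert.1 hy).resolve_left hya)]

/-- On finite input sets every function has an exact protocol. -/
theorem exists_run_eq [Finite X] [Finite Y] [Nonempty Z] (g : X → Y → Z) :
    ∃ π : CommProtocol X Y Z, ∀ x y, π.run x y = g x y := by
  have := Fintype.ofFinite X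
  have := Fintype.ofFinite Y
  obtain ⟨z₀⟩ := ‹Nonempty Z›
  choose k hk using fun x => exists_run_eq_of_mem' (X := X) (Finset.univ : Finset Y) (g x) z₀
  obtain ⟨π, hπ⟩ := exists_run_eq_of_mem Finset.univ k (output z₀)
  exact ⟨π, fun x y => by
    rw [hπ x (Finset.mem_univ x), hk x x y (Finset.mem_univ y)]⟩

/-- An exact protocol exists, so the infimum is attained and is not the default value `0` of an
empty set. -/
theorem exists_distCCPow [Fintype X] [Fintype Y] [Nonempty Z] (μ : X × Y → ℝ) {ε : ℝ}
    (hε : 0 ≤ ε) (f : X → Y → Z) (n : ℕ) :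
    ∃ π : CommProtocol (Fin n → X) (Fin n → Y) (Fin n → Z), π.cost = distCCPow μ ε f n ∧
      ∀ i : Fin n, eventProb (powDist μ n)
        (fun p => π.run p.1 p.2 i ≠ f (p.1 i) (p.2 i)) ≤ ε := by
  obtain ⟨π, hπ⟩ := exists_run_eq fun (x : Fin n → X) (y : Fin n → Y) i => f (x i) (y i)
  exact Nat.sInf_mem (s := {c : ℕ | ∃ π : CommProtocol (Fin n → X) (Fin n → Y) (Fin n → Z),
    π.cost = c ∧ ∀ i : Fin n, eventProb (powDist μ n)
      (fun p => π.run p.1 p.2 i ≠ f (p.1 i) (p.2 i)) ≤ ε})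
    ⟨π.cost, π, rfl, fun i => by simpa [eventProb, hπ] using hε⟩

theorem distCC_le [Fintype X] [Fintype Y] {μ : X × Y → ℝ} {ε : ℝ} {f : X → Y → Z}
    (π : CommProtocol X Y Z) (hπ : eventProb μ (fun p => π.run p.1 p.2 ≠ f p.1 p.2) ≤ ε) :
    distCC μ ε f ≤ π.cost :=
  Nat.sInf_le ⟨π, rfl, hπ⟩

/-- If the cost of a protocol for `n` copies is small compared with `√n`, then `f` is nearly
constant. -/
theorem distCC_eq_zero [Fintype X] [Fintype Y] {n : ℕ} (hn : 0 < n) {μ : X × Y → ℝ}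
    (hμ : μ ∈ stdSimplex ℝ (X × Y)) (f : X → Y → Bool) {ε δ : ℝ}
    (π : CommProtocol (Fin n → X) (Fin n → Y) (Fin n → Bool))
    (hπ : ∀ i : Fin n, eventProb (powDist μ n)
      (fun p => π.run p.1 p.2 i ≠ f (p.1 i) (p.2 i)) ≤ ε) (hC : π.cost / √n ≤ δ) :
    distCC μ (ε + δ) f = 0 := by
  let μ' : (X × Y) × Unit → ℝ := fun p => μ p.1
  have hμ' : μ' ∈ stdSimplex ℝ ((X × Y) × Unit) := by
    refine ⟨fun p => hμ.1 _, ?_⟩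
    rw [Fintype.sum_prod_type]
    simpa [μ'] using hμ.2
  -- With all inputs given to Alice, Bob's path depends on the shared randomness alone. Unless a
  -- disagreement occurs, it equals the joint path, so its label is a constant guess for `f` with
  -- little extra error.
  let π' : CommProtocol (Fin n → X × Y) (Fin n → Unit) (Fin n → Bool) :=
    π.merge (fun z i => (z i).1) fun z i => (z i).2
  have hcost : π'.cost = π.cost := cost_merge _ _ _
  have hπ' : ∀ i : Fin n, eventProb (powDist μ' n)
      (fun p => π'.run p.1 p.2 i ≠ (fun q (_ : Unit) => f q.1 q.2) (p.1 i) (p.2 i)) ≤ ε := by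
    intro i
    refine (le_of_eq ?_).trans (hπ i)
    rw [eventProb_eq_sum, eventProb_eq_sum,
      ← (Equiv.arrowProdEquivProdArrow (Fin n) (fun _ => X) fun _ => Y).sum_comp,
      Fintype.sum_prod_type]
    refine Finset.sum_congr rfl fun z _ => ?_
    rw [Fintype.sum_unique]
    simp only [π', run_merge]
    rfl
  obtain ⟨j, Θ, _, w, a, b, hw0, hw1, herr, hmis⟩ :=
    exists_coupled_simulation hn hμ' (fun q (_ : Unit) => f q.1 q.2) π' hπ'
  rw [hcost] at herr hmis
  simp only [Finset.univ_unique, Finset.sum_singleton, PUnit.default_eq_unit] at herr hmis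
  set own : List Bool → Bool := fun v => (π'.subtree v).aliceOwned
  let out : Θ → Bool := fun θ =>
    (π'.subtree (extendHistory (b θ ()) [] π.cost)).leftLabel j
  obtain ⟨θ, hθ⟩ := exists_le_of_weighted_sum_le (w := w)
    (F := fun θ => ∑ x, ∑ y, μ (x, y) * if out θ ≠ f x y then 1 else 0) (B := ε + δ) hw0 hw1 (by
      refine le_trans ?_ (add_le_add herr (hmis.trans hC))
      rw [← Finset.sum_add_distrib]
      refine Finset.sum_le_sum fun θ _ => ?_
      rw [← mul_add, Fintype.sum_prod_type, Fintype.sum_prod_type, ← Finset.sum_add_distrib]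
      refine mul_le_mul_of_nonneg_left (Finset.sum_le_sum fun x _ => ?_) (hw0 θ)
      rw [← Finset.sum_add_distrib]
      refine Finset.sum_le_sum fun y _ => ?_
      rw [← mul_add]
      refine mul_le_mul_of_nonneg_left ?_ (hμ.1 _)
      by_cases h0 : ∀ t < π.cost,
          a θ (x, y) (extendHistory (ownerBit own (a θ (x, y)) (b θ ())) [] t) =
          b θ () (extendHistory (ownerBit own (a θ (x, y)) (b θ ())) [] t)
      · have h1 : extendHistory (b θ ()) [] π.cost =
            extendHistory (ownerBit own (a θ (x, y)) (b θ ())) [] π.cost := by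
          apply extendHistory_eq_of_agree
          intro i hi
          rw [ownerBit, h0 i hi, Bool.cond_self]
        simp only [out, h1]
        exact le_add_of_nonneg_right (Nat.cast_nonneg _)
      · push Not at h0
        obtain ⟨t, ht, hne⟩ := h0
        have h1 : 1 ≤ ((Finset.range π.cost).filter fun t =>
            a θ (x, y) (extendHistory (ownerBit own (a θ (x, y)) (b θ ())) [] t) ≠
            b θ () (extendHistory (ownerBit own (a θ (x, y)) (b θ ())) [] t)).card :=
          Finset.card_pos.2 ⟨t, Finset.mem_filter.2 ⟨Finset.mem_range.2 ht, hne⟩⟩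
        have h2 : (1 : ℝ) ≤ (((Finset.range π.cost).filter fun t =>
            a θ (x, y) (extendHistory (ownerBit own (a θ (x, y)) (b θ ())) [] t) ≠
            b θ () (extendHistory (ownerBit own (a θ (x, y)) (b θ ())) [] t)).card : ℝ) := by
          exact_mod_cast h1
        refine le_trans ?_ (h2.trans (le_add_of_nonneg_left ?_)) <;> split_ifs <;> norm_num)
  have := distCC_le (μ := μ) (ε := ε + δ) (f := f) (output (out θ)) (by
    rw [eventProb_eq_sum, Fintype.sum_prod_type]
    exact hθ)
  simpa [cost] using this

end Constant

/-- The cost of the protocol for one copy obtained by compressing a protocol for `n` copies. -/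
theorem distCC_le_compressed {X Y : Type*} [Fintype X] [Fintype Y] {n : ℕ} (hn : 0 < n)
    {μ : X × Y → ℝ} (hμ : μ ∈ stdSimplex ℝ (X × Y)) (f : X → Y → Bool) {ε δ : ℝ}
    (π : CommProtocol (Fin n → X) (Fin n → Y) (Fin n → Bool))
    (hπ : ∀ i : Fin n, eventProb (powDist μ n)
      (fun p => π.run p.1 p.2 i ≠ f (p.1 i) (p.2 i)) ≤ ε) (hC : π.cost ≠ 0) {K s : ℕ}
    (hK : π.cost / √n / (K + 1) ≤ δ / 2) (hs : ((π.cost : ℝ) + 1) ^ 2 / 2 ^ s ≤ δ / 2) :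
    distCC μ (ε + δ) f ≤ K * ((Nat.log 2 π.cost + 1) * (s + 1) + 1) + 1 := by
  obtain ⟨j, Θ, _, w, a, b, hw0, hw1, herr, hmis⟩ := exists_coupled_simulation hn hμ f π hπ
  obtain ⟨τ, h1, h2⟩ := exists_simulating_protocol (K := K) (L := Nat.log 2 π.cost + 1) (s := s)
    (lab := fun v => (π.subtree v).leftLabel j) hμ f hw0 hw1
    (fun c v hv => congrFun (leftLabel_subtree_cons π c hv) j) herr hmis
    (fun i hi => Nat.pow_le_of_le_log hC (Nat.le_of_lt_succ hi))
    (Nat.lt_pow_succ_log_self one_lt_two _)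
  exact (distCC_le τ (h2.trans (by linarith))).trans h1

end CommProtocol

/-! ### Choice of parameters and the final bound. -/

theorem exists_distCC_le (δ : ℝ) (hδ : 0 < δ) : ∃ B : ℝ, 0 < B ∧
    ∀ {X Y : Type*} [Fintype X] [Fintype Y] {n : ℕ} (_ : 0 < n) {μ : X × Y → ℝ}
      (_ : μ ∈ stdSimplex ℝ (X × Y)) (f : X → Y → Bool) {ε : ℝ} (_ : 0 ≤ ε),
      √n * distCC μ (ε + δ) f ≤
        B * distCCPow μ ε f n * Real.log (2 + distCCPow μ ε f n) ^ 2 := by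
  have hl2 : 0 < Real.log 2 := Real.log_pos one_lt_two
  -- Chosen so that `s + 2 ≤ b * ℓ` below: the `2` comes from the square of `C + 1`, the `3` from
  -- rounding `s` up and from the summand `2`.
  set b : ℝ := (|Real.log (2 / δ)| / Real.log 2 + 2 + 3) / Real.log 2 with hb
  have hb0 : 0 < b := by positivity
  refine ⟨(4 * (b / Real.log 2) + 1 / Real.log 2 ^ 2) / δ, by positivity, ?_⟩
  intro X Y _ _ n hn μ hμ f ε hε
  obtain ⟨π, hcost, hπ⟩ := CommProtocol.exists_distCCPow μ hε f n
  rw [← hcost]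
  set C := π.cost
  have hr : 0 < √(n : ℝ) := Real.sqrt_pos.2 (by exact_mod_cast hn)
  -- The compressed protocol sends at least one final bit, which can be absorbed into a multiple of
  -- `C / √n` only when that ratio is bounded below.
  rcases le_or_gt ((C : ℝ) / √n) δ with hsmall | hbig
  · rw [CommProtocol.distCC_eq_zero hn hμ f π hπ hsmall]
    simp only [Nat.cast_zero, mul_zero]
    positivity
  have hC0 : C ≠ 0 := by
    intro h
    rw [h] at hbig; simp at hbig; linarith
  set ℓ := Real.log (2 + C) with hℓ
  have hC1 : (1 : ℝ) ≤ C := by exact_mod_cast Nat.one_le_iff_ne_zero.2 hC0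
  have hℓ2 : Real.log 2 ≤ ℓ := Real.log_le_log (by norm_num) (by linarith)
  have hℓ0 : 0 < ℓ := hl2.trans_le hℓ2
  set R : ℝ := C / √n with hR
  -- The error budget `δ` is split evenly: `K` makes the Markov term at most `δ / 2`, and `s` does
  -- the same for hash collisions.
  set K : ℕ := ⌊2 * R / δ⌋₊
  have hR0 : 0 < R := hδ.trans hbig
  have hKle : (K : ℝ) ≤ 2 * R / δ := Nat.floor_le (by positivity)
  have hKlt : 2 * R / δ < K + 1 := Nat.lt_floor_add_one _
  set q : ℝ := Real.log (2 * (C + 1) ^ 2 / δ) / Real.log 2 with hq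
  set s : ℕ := ⌈q⌉₊
  have hs1 : ((C : ℝ) + 1) ^ 2 / 2 ^ s ≤ δ / 2 := by
    rw [div_le_div_iff₀ (by positivity) (by norm_num)]
    have h1 : Real.log (2 * (C + 1) ^ 2 / δ) ≤ s * Real.log 2 := by
      rw [← div_le_iff₀ hl2]; exact Nat.le_ceil q
    rw [← Real.log_pow] at h1
    have h2 := (Real.log_le_log_iff (by positivity) (by positivity)).1 h1
    rw [div_le_iff₀ hδ] at h2
    linarith
  have hq1 : q ≤ |Real.log (2 / δ)| / Real.log 2 + 2 * ℓ / Real.log 2 := by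
    rw [hq, ← add_div]
    refine div_le_div_of_nonneg_right ?_ hl2.le
    have h1 : 2 * ((C : ℝ) + 1) ^ 2 / δ = 2 / δ * (C + 1) ^ 2 := by ring
    rw [h1, Real.log_mul (by positivity) (by positivity), Real.log_pow]
    have h2 : Real.log (C + 1) ≤ ℓ := Real.log_le_log (by positivity) (by linarith)
    have h3 := le_abs_self (Real.log (2 / δ))
    push_cast
    linarith
  have hs2 : (s : ℝ) + 2 ≤ b * ℓ := by
    have h1 : (s : ℝ) ≤ max q 0 + 1 := by
      rcases le_total q 0 with h | h
      · have : s = 0 := Nat.ceil_eq_zero.2 h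
        rw [this, Nat.cast_zero]; positivity
      · rw [max_eq_left h]; exact (Nat.ceil_lt_add_one h).le
    have h2 : max q 0 ≤ |Real.log (2 / δ)| / Real.log 2 + 2 * ℓ / Real.log 2 :=
      max_le hq1 (by positivity)
    have h3 : 1 ≤ ℓ / Real.log 2 := (one_le_div hl2).2 hℓ2
    have h4 : |Real.log (2 / δ)| / Real.log 2 ≤
        |Real.log (2 / δ)| / Real.log 2 * (ℓ / Real.log 2) :=
      le_mul_of_one_le_right (by positivity) h3
    have h5 : b * ℓ = |Real.log (2 / δ)| / Real.log 2 * (ℓ / Real.log 2) +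
        2 * ℓ / Real.log 2 + 3 * (ℓ / Real.log 2) := by
      rw [hb]; ring
    linarith
  have hL : ((Nat.log 2 C : ℝ) + 1) ≤ 2 * (ℓ / Real.log 2) := by
    have h1 : (Nat.log 2 C : ℝ) * Real.log 2 ≤ ℓ := by
      rw [← Real.log_pow]
      refine Real.log_le_log (by positivity) ?_
      have : ((2 ^ Nat.log 2 C : ℕ) : ℝ) ≤ C := by exact_mod_cast Nat.pow_log_le_self 2 hC0
      push_cast at this
      linarith
    have h2 : (Nat.log 2 C : ℝ) ≤ ℓ / Real.log 2 := (le_div_iff₀ hl2).2 h1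
    have h3 : 1 ≤ ℓ / Real.log 2 := (one_le_div hl2).2 hℓ2
    linarith
  have hD := CommProtocol.distCC_le_compressed (δ := δ) hn hμ f π hπ hC0 (K := K) (s := s)
    (by
      rw [div_le_iff₀ (by positivity)]
      rw [div_lt_iff₀ hδ] at hKlt
      linarith) hs1
  have hD' : (distCC μ (ε + δ) f : ℝ) ≤ K * ((Nat.log 2 C + 1) * (s + 1) + 1) + 1 := by
    exact_mod_cast hD
  have hfac : ((Nat.log 2 C : ℝ) + 1) * (s + 1) + 1 ≤ 2 * (b / Real.log 2) * ℓ ^ 2 := by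
    have h1 : ((Nat.log 2 C : ℝ) + 1) * (s + 1) + 1 ≤ (Nat.log 2 C + 1) * (s + 2) := by
      have : (0 : ℝ) ≤ Nat.log 2 C := Nat.cast_nonneg _
      linarith
    refine h1.trans ((mul_le_mul hL hs2 (by positivity) (by positivity)).trans (le_of_eq ?_))
    ring
  have hone : 1 ≤ R / δ * (1 / Real.log 2 ^ 2 * ℓ ^ 2) := by
    have h1 : 1 ≤ R / δ := (one_le_div hδ).2 hbig.le
    have h2 : 1 ≤ 1 / Real.log 2 ^ 2 * ℓ ^ 2 := by
      rw [one_div_mul_eq_div, one_le_div (by positivity)]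
      exact pow_le_pow_left₀ hl2.le hℓ2 2
    nlinarith
  have hfin : (distCC μ (ε + δ) f : ℝ) ≤
      (4 * (b / Real.log 2) + 1 / Real.log 2 ^ 2) / δ * R * ℓ ^ 2 := by
    calc (distCC μ (ε + δ) f : ℝ) ≤ K * ((Nat.log 2 C + 1) * (s + 1) + 1) + 1 := hD'
      _ ≤ 2 * R / δ * (2 * (b / Real.log 2) * ℓ ^ 2) + R / δ * (1 / Real.log 2 ^ 2 * ℓ ^ 2) :=
        add_le_add (mul_le_mul hKle hfac (by positivity) (by positivity)) hone
      _ = _ := by ring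
  calc √(n : ℝ) * distCC μ (ε + δ) f ≤
      √n * ((4 * (b / Real.log 2) + 1 / Real.log 2 ^ 2) / δ * R * ℓ ^ 2) :=
        mul_le_mul_of_nonneg_left hfin hr.le
    _ = _ := by rw [hR]; field_simp

theorem mainTheorem5 :
    ∃ k : ℕ, ∀ δ : ℝ, 0 < δ → ∃ c : ℝ, 0 < c ∧
      ∀ (X : Type*) (Y : Type*) [Fintype X] [Fintype Y] (f : X → Y → Bool)
        (μ : X × Y → ℝ), μ ∈ stdSimplex ℝ (X × Y) →
        ∀ (ε : ℝ), 0 ≤ ε → ∀ n : ℕ,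
          c * ((√n * distCC μ (ε + δ) f) / Real.log (2 + √n * distCC μ (ε + δ) f) ^ k)
            ≤ distCCPow μ ε f n := by
  refine ⟨2, fun δ hδ => ?_⟩
  obtain ⟨B, hB, hmain⟩ := exists_distCC_le δ hδ
  have hl2 : 0 < Real.log 2 := Real.log_pos one_lt_two
  refine ⟨min (Real.log 2 ^ 2) (1 / B), by positivity, ?_⟩
  intro X Y _ _ f μ hμ ε hε n
  rcases Nat.eq_zero_or_pos n with rfl | hn
  · simp
  have h := hmain hn hμ f hε
  set g : ℝ := √n * distCC μ (ε + δ) f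
  set C : ℝ := (distCCPow μ ε f n : ℝ)
  have hg : 0 ≤ g := by positivity
  have hC : 0 ≤ C := Nat.cast_nonneg _
  have hlog : Real.log 2 ≤ Real.log (2 + g) := Real.log_le_log (by norm_num) (by linarith)
  have hlog0 : 0 < Real.log (2 + g) := hl2.trans_le hlog
  rw [mul_div_assoc', div_le_iff₀ (by positivity)]
  -- If `g ≤ C`, it suffices that the logarithm is at least `log 2`. Otherwise `log (2 + C) ≤ log (2
  -- + g)` turns the bound in `C` into one in `g`.
  rcases le_total g C with hgC | hgC
  · calc min (Real.log 2 ^ 2) (1 / B) * g ≤ Real.log 2 ^ 2 * C := by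
          gcongr; exact min_le_left _ _
      _ ≤ Real.log (2 + g) ^ 2 * C := by gcongr
      _ = _ := by ring
  · calc min (Real.log 2 ^ 2) (1 / B) * g ≤ 1 / B * (B * C * Real.log (2 + C) ^ 2) := by
          gcongr; exact min_le_right _ _
      _ = C * Real.log (2 + C) ^ 2 := by field_simp
      _ ≤ _ := by
          have : 0 ≤ Real.log (2 + C) := Real.log_nonneg (by linarith)
          gcongr
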